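/- Let $n\ge 3$. Throughout, $B(x,r)\subset\mathbb R^n$ is the open ball, $A(x;s,t)=B(x,t)\setminus B(x,s)$, and a domain is a nonempty open connected set. For $1\le q<\infty$, a domain $\Omega\subset\mathbb R^n$ and bounded sets $E,F\subset\overline\Omega$ with $\operatorname{dist}(E,F)>0$, put $$\mathrm{Cap}_q(E,F;\Omega)=\inf_u\int_\Omega|\nabla u|^q\,dx,$$ the infimum being over all $u\in W^{1,q}(\Omega)\cap C(\Omega\cup E\cup F)$ with $u\ge 1$ on $E$ and $u\le 0$ on $F$. A set $E\subset\mathbb R^n$ is *$q$-capacitory dense* at $z\in\mathbb R^n$ if $$\limsup_{r\to0^+}\frac{\mathrm{Cap}_q\big(E\cap B(z,\frac r4),\,E\cap A(z;\frac r2,\frac{3r}4);\,B(z,r)\big)}{\mathrm{Cap}_q\big(B(z,\frac r4),\,A(z;\frac r2,\frac{3r}4);\,B(z,r)\big)}>0 .$$ For $1<q<\infty$ the set $E$ is *$q$-thin* at $x\in\mathbb R^n$ if $$\int_0^1\left(\frac{\mathrm{Cap}_q\big(E\cap B(x,t),A(x;2t,3t);B(x,4t)\big)}{\mathrm{Cap}_q\big(B(x,t),A(x;2t,3t);B(x,4t)\big)}\right)^{\frac1{q-1}}\frac{dt}t<\infty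 ,$$ and it is *$1$-thin* at $x$ if $\lim_{t\to0^+}t\,\mathrm{Cap}_1\big(E\cap B(x,t),A(x;2t,3t);B(x,4t)\big)/|B(x,t)|=0$. It is *$q$-fat* at $x$ if it is not $q$-thin at $x$. A *doubling cusp function* is a continuous, (strictly) increasing, differentiable function $w:[0,\infty)\to[0,\infty)$ with $w(0)=0$ and $w(1)=1$, such that $w(2t)\le C\,w(t)$ for all $t>0$ and some constant $C$, and such that $w'$ is (strictly) increasing on $(0,1)$ with $\lim_{t\to0^+}w'(t)=0$. Its outward cusp domain is $$\Omega^n_w=\{(t,x)\in\mathbb R\times\mathbb R^{n-1}:0<t\le1,\ |x|<w(t)\}\cup B\big((2,0),\sqrt2\big).$$ Then: 1. If a domain $\Omega\subset\mathbb R^n$ is $q$-capacitory dense at a point $x\in\mathbb R^n$ for some $1\le q<\infty$, then $\Omega$ is $q$-fat at $x$ (for the same $q$). 2. For every real $q$ with $1<q\le n-1$ there is a doubling cusp function $w$ such that $\Omega^n_w$ is a domain which is $q$-fat but not $q$-capacitory dense at the origin. -/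

import Mathlib

open Set Filter Topology MeasureTheory
open scoped ENNReal ContDiff

noncomputable section

namespace CapacityDensity

/-- A domain: a nonempty, open and connected set. -/
def IsDomainSet {n : ℕ} (Ω : Set (EuclideanSpace ℝ (Fin n))) : Prop :=
  IsOpen Ω ∧ IsConnected Ω

/-- `G` is a weak gradient of `u` on the open set `Ω`: both are locally integrable on `Ω`, and
`∫ u ∂ᵢφ = - ∫ Gᵢ φ` for every index `i` and every smooth `φ` with compact support in `Ω`. -/
def IsWeakGradient {n : ℕ} (Ω : Set (EuclideanSpace ℝ (Fin n)))
    (u : EuclideanSpace ℝ (Fin n) → ℝ)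
    (G : EuclideanSpace ℝ (Fin n) → EuclideanSpace ℝ (Fin n)) : Prop :=
  LocallyIntegrableOn u Ω ∧ LocallyIntegrableOn G Ω ∧
    ∀ φ : EuclideanSpace ℝ (Fin n) → ℝ, ContDiff ℝ ∞ φ → HasCompactSupport φ → tsupport φ ⊆ Ω →
      ∀ i : Fin n,
        ∫ x in Ω, u x * fderiv ℝ φ x (EuclideanSpace.single i 1) = - ∫ x in Ω, G x i * φ x

/-- `u` belongs to the Sobolev space `W^{1,p}(Ω)`. -/
def MemSobolev {n : ℕ} (p : ℝ) (Ω : Set (EuclideanSpace ℝ (Fin n)))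
    (u : EuclideanSpace ℝ (Fin n) → ℝ) : Prop :=
  MemLp u (ENNReal.ofReal p) (volume.restrict Ω) ∧
    ∃ G : EuclideanSpace ℝ (Fin n) → EuclideanSpace ℝ (Fin n),
      IsWeakGradient Ω u G ∧ MemLp G (ENNReal.ofReal p) (volume.restrict Ω)

/-- The admissible functions for the triple `(E, F; Ω)`: the elements of
`W^{1,p}(Ω) ∩ C(Ω ∪ E ∪ F)` that are at least `1` on `E` and at most `0` on `F`. -/
def admissible {n : ℕ} (p : ℝ) (E F Ω : Set (EuclideanSpace ℝ (Fin n))) :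
    Set (EuclideanSpace ℝ (Fin n) → ℝ) :=
  {u | MemSobolev p Ω u ∧ ContinuousOn u (Ω ∪ E ∪ F) ∧ (∀ x ∈ E, 1 ≤ u x) ∧ ∀ x ∈ F, u x ≤ 0}

/-- The variational `p`-capacity `Cap_p(E, F; Ω)`, the infimum of `∫_Ω |∇u|^p` over the admissible
functions `u`. (The weak gradient of `u` is unique almost everywhere in `Ω`.) -/
def capacity {n : ℕ} (p : ℝ) (E F Ω : Set (EuclideanSpace ℝ (Fin n))) : ℝ≥0∞ :=
  ⨅ u ∈ admissible p E F Ω,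
    ⨅ (G : EuclideanSpace ℝ (Fin n) → EuclideanSpace ℝ (Fin n)) (_ : IsWeakGradient Ω u G),
      ∫⁻ x in Ω, ‖G x‖ₑ ^ p

/-- The annulus `A(x; s, t) = B(x, t) \ B(x, s)`. -/
def annulus {n : ℕ} (x : EuclideanSpace ℝ (Fin n)) (s t : ℝ) : Set (EuclideanSpace ℝ (Fin n)) :=
  Metric.ball x t \ Metric.ball x s

/-- `E` is `p`-capacitory dense at `z`. -/
def IsCapacitoryDense {n : ℕ} (p : ℝ) (E : Set (EuclideanSpace ℝ (Fin n)))
    (z : EuclideanSpace ℝ (Fin n)) : Prop :=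
  0 < limsup (fun r : ℝ =>
      capacity p (E ∩ Metric.ball z (r / 4)) (E ∩ annulus z (r / 2) (3 * r / 4)) (Metric.ball z r) /
        capacity p (Metric.ball z (r / 4)) (annulus z (r / 2) (3 * r / 4)) (Metric.ball z r))
    (𝓝[>] (0 : ℝ))

/-- `E` is `p`-thin at `x` (for `1 ≤ p < ∞`). -/
def IsThin {n : ℕ} (p : ℝ) (E : Set (EuclideanSpace ℝ (Fin n)))
    (x : EuclideanSpace ℝ (Fin n)) : Prop :=
  if p = 1 then
    Tendsto (fun t : ℝ =>
        ENNReal.ofReal t *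
            capacity 1 (E ∩ Metric.ball x t) (annulus x (2 * t) (3 * t)) (Metric.ball x (4 * t)) /
          volume (Metric.ball x t))
      (𝓝[>] (0 : ℝ)) (𝓝 0)
  else
    ∫⁻ t in Ioo (0 : ℝ) 1,
      (capacity p (E ∩ Metric.ball x t) (annulus x (2 * t) (3 * t)) (Metric.ball x (4 * t)) /
          capacity p (Metric.ball x t) (annulus x (2 * t) (3 * t)) (Metric.ball x (4 * t))) ^
          (1 / (p - 1)) / ENNReal.ofReal t < (⊤ : ℝ≥0∞)

/-- `E` is `p`-fat at `x`: it is not `p`-thin there. -/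
def IsFat {n : ℕ} (p : ℝ) (E : Set (EuclideanSpace ℝ (Fin n)))
    (x : EuclideanSpace ℝ (Fin n)) : Prop :=
  ¬ IsThin p E x

/-- Doubling cusp functions `w : [0, ∞) → [0, ∞)`; only the values on `[0, ∞)` matter, and there
`w ≥ 0` because `w 0 = 0` and `w` is increasing. -/
structure IsCuspFunction (w : ℝ → ℝ) : Prop where
  continuousOn : ContinuousOn w (Ici 0)
  strictMonoOn : StrictMonoOn w (Ici 0)
  differentiableOn : DifferentiableOn ℝ w (Ici 0)
  map_zero : w 0 = 0
  map_one : w 1 = 1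
  doubling : ∃ C : ℝ, ∀ t : ℝ, 0 < t → w (2 * t) ≤ C * w t
  deriv_strictMonoOn : StrictMonoOn (deriv w) (Ioo 0 1)
  tendsto_deriv : Tendsto (deriv w) (𝓝[>] 0) (𝓝 0)

/-- The outward cusp domain `{(t, x) ∈ ℝ × ℝ^{n-1} : 0 < t ≤ 1, |x| < w t} ∪ B((2, 0), √2)`;
the coordinate `0` of a point `z` is `t`, and `z - (t, 0)` is `(0, x)`. -/
def cuspDomain (n : ℕ) [NeZero n] (w : ℝ → ℝ) : Set (EuclideanSpace ℝ (Fin n)) :=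
  {z | 0 < z 0 ∧ z 0 ≤ 1 ∧ ‖z - EuclideanSpace.single 0 (z 0)‖ < w (z 0)} ∪
    Metric.ball (EuclideanSpace.single 0 2) (√2)

end CapacityDensity

end

namespace CapacityDensity

variable {n : ℕ}

local notation "𝔼" => EuclideanSpace ℝ (Fin n)

/-! Let Q(t) be the quotient in the definition of thinness, with the full annulus as zero set.
Density at a point only says that Q(t) exceeds some δ > 0 along a sequence of scales t → 0, because
replacing the annulus by its part in E lowers the capacity. Such a bound spreads over scales:
`exists_capacity_div_le` gives Q(s) ≤ C Q(t) for s ≤ t ≤ 2s. One good scale s therefore contributes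
at least (δ/C)^(1/(q-1))/2 to the thinness integral over (s, 2s). If that integral were finite,
these contributions would tend to 0. For q = 1 the capacity of a ball is at least a multiple of
t^(n-1), so the quantity in the definition of thinness dominates Q(t) directly.

All capacity estimates are reduced to smooth functions vanishing off B(x, 2t)
(`exists_isTestFunction`). For these a Poincaré inequality holds; with Chebyshev's inequality it
gives |S| ≤ C t^q Cap(S), and hence, with dilated cutoffs, Cap(B(x, t)) ≈ t^(n-q).

For the second claim take w(t) = t L(t)^(-α) near 0, where L(t) = 1 - log t and α = (q-1)/n. The
cusp inside B(0, t) contains a ball of radius w(t/4), so Q(t) ≥ c (w(t/4)/t)^n, which is a multiple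
of L(t/4)^(-(q-1)). The power 1/(q-1) turns this into 1/L(t/4), and ∫ dt/(t L(t/4)) diverges: the
cusp is fat. On the other hand w(t)/t → 0, so after rescaling to unit size the cusp lies in ever
thinner cylinders about a segment. For 1 < q ≤ n-1 a segment has zero q-capacity
(`exists_small_energy`), so the density quotient tends to 0. The logarithmic rate is slow enough for
the integral to diverge and still tends to zero. -/

/-! ### Jensen and Poincaré inequalities -/

/-- Jensen's inequality for powers of lower Lebesgue integrals. -/
theorem lintegral_rpow_le_lintegral_rpow {α : Type*} [MeasurableSpace α] {μ : Measure α}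
    [IsProbabilityMeasure μ] {q : ℝ} (hq : 1 ≤ q) {f : α → ℝ≥0∞} (hf : AEMeasurable f μ) :
    (∫⁻ a, f a ∂μ) ^ q ≤ ∫⁻ a, f a ^ q ∂μ := by
  have h := eLpNorm'_le_eLpNorm'_of_exponent_le (ε := ℝ≥0∞) one_pos hq μ hf.aestronglyMeasurable
  have hq0 : 0 < q := by linarith
  simp only [eLpNorm', enorm_eq_self, ENNReal.rpow_one, ne_eq, one_ne_zero, not_false_eq_true,
    div_self] at h
  rw [one_div, ENNReal.le_rpow_inv_iff hq0] at h
  exact h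

/-- Jensen's inequality with a weight of total mass one. -/
theorem lintegral_mul_rpow_le {α : Type*} [MeasurableSpace α] {μ : Measure α} {q : ℝ} (hq : 1 ≤ q)
    {k f : α → ℝ≥0∞} (hk : AEMeasurable k μ) (hk1 : ∫⁻ a, k a ∂μ = 1) (hf : AEMeasurable f μ) :
    (∫⁻ a, k a * f a ∂μ) ^ q ≤ ∫⁻ a, k a * f a ^ q ∂μ := by
  have hP : IsProbabilityMeasure (μ.withDensity k) := ⟨by simpa using hk1⟩
  have hac := withDensity_absolutelyContinuous μ k
  have h := lintegral_rpow_le_lintegral_rpow hq (hf.mono_ac hac)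
  rwa [lintegral_withDensity_eq_lintegral_mul₀ hk hf,
    lintegral_withDensity_eq_lintegral_mul₀ hk (hf.pow_const q)] at h

/-- A smooth compactly supported function vanishing off a ball of radius `2t` satisfies the
Poincaré inequality. -/
theorem lintegral_rpow_le_of_support {E : Type*} [NormedAddCommGroup E] [NormedSpace ℝ E]
    [MeasurableSpace E] [BorelSpace E] [FiniteDimensional ℝ E] [Nontrivial E]
    (μ : Measure E) [μ.IsAddHaarMeasure]
    {v : E → ℝ} (hv : ContDiff ℝ ∞ v) {x : E} {t q : ℝ} (ht : 0 < t) (hq : 1 ≤ q)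
    (h0 : ∀ y, 2 * t ≤ dist y x → v y = 0) :
    ∫⁻ y, ‖v y‖ₑ ^ q ∂μ ≤ ENNReal.ofReal (4 * t) ^ q * ∫⁻ y, ‖fderiv ℝ v y‖ₑ ^ q ∂μ := by
  -- A translation by length 4t, the diameter of the ball, carries B(x, 2t) off itself. So v(y + e)
  -- = 0 wherever v(y) may be nonzero, and v(y) is minus the integral of the derivative along the
  -- segment from y to y + e.
  obtain ⟨e, he⟩ := exists_norm_eq E (c := 4 * t) (by positivity)
  have hq0 : 0 < q := by linarith
  have hcont : Continuous (fderiv ℝ v) := hv.continuous_fderiv (by simp)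
  have hpt : ∀ y, ‖v y‖ₑ ≤ ∫⁻ s in Ioc (0 : ℝ) 1,
      ENNReal.ofReal (4 * t) * ‖fderiv ℝ v (y + s • e)‖ₑ := by
    intro y
    by_cases hy : 2 * t ≤ dist y x
    · simp [h0 y hy]
    have h1 : v (y + e) = 0 := by
      apply h0
      have h2 : ‖e‖ ≤ dist (y + e) x + dist y x := by
        rw [dist_eq_norm, dist_eq_norm]
        calc ‖e‖ = ‖(y + e - x) - (y - x)‖ := by congr 1; abel
          _ ≤ _ := norm_sub_le _ _
      push Not at hy
      linarith
    have hder : ∀ s ∈ uIcc (0 : ℝ) 1,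
        HasDerivAt (fun s : ℝ => v (y + s • e)) (fderiv ℝ v (y + s • e) e) s := by
      intro s _
      have hl : HasDerivAt (fun s : ℝ => y + s • e) e s := by
        simpa using ((hasDerivAt_id s).smul_const e).const_add y
      exact ((hv.differentiable (by simp)) (y + s • e)).hasFDerivAt.comp_hasDerivAt s hl
    have hc2 : Continuous fun s : ℝ => fderiv ℝ v (y + s • e) e := by fun_prop
    have h3 := intervalIntegral.integral_eq_sub_of_hasDerivAt hder (hc2.intervalIntegrable 0 1)
    simp only [one_smul, h1, zero_smul, add_zero, zero_sub] at h3
    rw [← enorm_neg, ← h3, intervalIntegral.integral_of_le zero_le_one]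
    refine (enorm_integral_le_lintegral_enorm _).trans (lintegral_mono fun s => ?_)
    have h4 := (fderiv ℝ v (y + s • e)).le_opENorm e
    rwa [mul_comm, ← ofReal_norm e, he] at h4
  have hprob : IsProbabilityMeasure (volume.restrict (Ioc (0 : ℝ) 1)) := ⟨by simp⟩
  have hm : Measurable fun p : E × ℝ => ‖fderiv ℝ v (p.1 + p.2 • e)‖ₑ ^ q := by
    have : Continuous fun p : E × ℝ => fderiv ℝ v (p.1 + p.2 • e) := by fun_prop
    exact this.enorm.measurable.pow_const q
  calc ∫⁻ y, ‖v y‖ₑ ^ q ∂μ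
      ≤ ∫⁻ y, (∫⁻ s in Ioc (0 : ℝ) 1,
          (ENNReal.ofReal (4 * t) * ‖fderiv ℝ v (y + s • e)‖ₑ) ^ q) ∂μ := by
        refine lintegral_mono fun y => ?_
        refine (ENNReal.rpow_le_rpow (hpt y) hq0.le).trans
          (lintegral_rpow_le_lintegral_rpow hq ?_)
        have : Continuous fun s : ℝ => fderiv ℝ v (y + s • e) := by fun_prop
        exact (this.enorm.measurable.const_mul _).aemeasurable
    -- After Tonelli, translation invariance makes the inner integral independent of s.
    _ = ∫⁻ s in Ioc (0 : ℝ) 1, (∫⁻ y,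
          (ENNReal.ofReal (4 * t) * ‖fderiv ℝ v (y + s • e)‖ₑ) ^ q ∂μ) := by
        rw [lintegral_lintegral_swap]
        refine Measurable.aemeasurable ?_
        simp only [Function.uncurry_def, ENNReal.mul_rpow_of_nonneg _ _ hq0.le]
        exact hm.const_mul _
    _ = ∫⁻ s in Ioc (0 : ℝ) 1,
          (ENNReal.ofReal (4 * t) ^ q * ∫⁻ y, ‖fderiv ℝ v y‖ₑ ^ q ∂μ) := by
        refine lintegral_congr fun s => ?_
        simp only [ENNReal.mul_rpow_of_nonneg _ _ hq0.le]
        rw [lintegral_const_mul _ (by fun_prop),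
          lintegral_add_right_eq_self (μ := μ) (fun y => ‖fderiv ℝ v y‖ₑ ^ q) (s • e)]
    _ = _ := by simp

/-! ### Smooth functions as competitors for the capacity -/

/-- The vector field representing the derivative of a function. -/
noncomputable def gradField (v : EuclideanSpace ℝ (Fin n) → ℝ) (y : EuclideanSpace ℝ (Fin n)) :
    EuclideanSpace ℝ (Fin n) :=
  (InnerProductSpace.toDual ℝ (EuclideanSpace ℝ (Fin n))).symm (fderiv ℝ v y)

theorem gradField_apply (v : 𝔼 → ℝ) (y : 𝔼) (i : Fin n) :
    gradField v y i = fderiv ℝ v y (EuclideanSpace.single i 1) := by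
  rw [← InnerProductSpace.toDual_symm_apply (𝕜 := ℝ) (y := fderiv ℝ v y)]
  rw [EuclideanSpace.inner_single_right]
  simp [gradField]

theorem enorm_gradField (v : 𝔼 → ℝ) (y : 𝔼) : ‖gradField v y‖ₑ = ‖fderiv ℝ v y‖ₑ := by
  simp [gradField, enorm_eq_nnnorm]

/-- The derivative of a compactly supported smooth function is a weak gradient. -/
theorem isWeakGradient_gradField {v : 𝔼 → ℝ} (hv : ContDiff ℝ ∞ v) (hc : HasCompactSupport v)
    (Ω : Set 𝔼) : IsWeakGradient Ω v (gradField v) := by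
  have hcf : Continuous (fderiv ℝ v) := hv.continuous_fderiv (by simp)
  have hcg : Continuous (gradField v) :=
    (InnerProductSpace.toDual ℝ _).symm.continuous.comp hcf
  refine ⟨hv.continuous.locallyIntegrable.locallyIntegrableOn _,
    hcg.locallyIntegrable.locallyIntegrableOn _, fun φ hφ hφc hφΩ i => ?_⟩
  have hcφ : Continuous (fderiv ℝ φ) := hφ.continuous_fderiv (by simp)
  have h0 : ∀ x, x ∉ Ω → φ x = 0 := fun x hx => image_eq_zero_of_notMem_tsupport fun h => hx (hφΩ h)
  have h0' : ∀ x, x ∉ Ω → fderiv ℝ φ x = 0 := fun x hx =>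
    image_eq_zero_of_notMem_tsupport fun h => hx (hφΩ (tsupport_fderiv_subset ℝ h))
  rw [setIntegral_eq_integral_of_forall_compl_eq_zero (fun x hx => by simp [h0' x hx]),
    setIntegral_eq_integral_of_forall_compl_eq_zero (fun x hx => by simp [h0 x hx])]
  simp only [gradField_apply]
  refine integral_mul_fderiv_eq_neg_fderiv_mul_of_integrable ?_ ?_ ?_
    (fun x _ => hv.differentiable (by simp) x) (fun x _ => hφ.differentiable (by simp) x)
  · exact Continuous.integrable_of_hasCompactSupport
      ((hcf.clm_apply continuous_const).mul hφ.continuous) hφc.mul_left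
  · exact Continuous.integrable_of_hasCompactSupport
      (hv.continuous.mul (hcφ.clm_apply continuous_const)) hc.mul_right
  · exact Continuous.integrable_of_hasCompactSupport (hv.continuous.mul hφ.continuous) hc.mul_right

/-- Smooth compactly supported test functions bound the capacity from above. -/
theorem capacity_le_of_contDiff {v : 𝔼 → ℝ} (hv : ContDiff ℝ ∞ v) (hc : HasCompactSupport v)
    {q : ℝ} {S F Ω : Set 𝔼} (h1 : ∀ y ∈ S, 1 ≤ v y) (h0 : ∀ y ∈ F, v y ≤ 0) :
    capacity q S F Ω ≤ ∫⁻ y, ‖fderiv ℝ v y‖ₑ ^ q := by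
  have hcf : Continuous (fderiv ℝ v) := hv.continuous_fderiv (by simp)
  have hcg : Continuous (gradField v) :=
    (InnerProductSpace.toDual ℝ _).symm.continuous.comp hcf
  have hw := isWeakGradient_gradField hv hc Ω
  have hgs : HasCompactSupport (gradField v) :=
    (hc.fderiv ℝ).comp_left (g := (InnerProductSpace.toDual ℝ _).symm) (by simp)
  have hadm : v ∈ admissible q S F Ω :=
    ⟨⟨(hv.continuous.memLp_of_hasCompactSupport hc).restrict _, gradField v, hw,
      (hcg.memLp_of_hasCompactSupport hgs).restrict _⟩, hv.continuous.continuousOn, h1, h0⟩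
  refine (iInf₂_le v hadm).trans ((iInf₂_le (gradField v) hw).trans ?_)
  simp only [enorm_gradField]
  exact setLIntegral_le_lintegral _ _

/-! ### Mollification of Sobolev functions -/

open scoped Convolution in
/-- The derivative of a mollification is the mollification of the weak gradient. -/
theorem enorm_fderiv_convolution_le {Ω : Set 𝔼} (hΩ : IsOpen Ω) {u : 𝔼 → ℝ} {G : 𝔼 → 𝔼}
    (hu : IntegrableOn u Ω) (hG : IsWeakGradient Ω u G) (ρ : ContDiffBump (0 : 𝔼)) {y : 𝔼}
    (hy : Metric.closedBall y ρ.rOut ⊆ Ω) :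
    ‖fderiv ℝ (ρ.normed volume ⋆[ContinuousLinearMap.lsmul ℝ ℝ, volume] Ω.indicator u) y‖ₑ ≤
      ∫⁻ z in Ω, ‖ρ.normed volume (y - z)‖ₑ * ‖G z‖ₑ := by
  have hcomm : (ρ.normed volume ⋆[ContinuousLinearMap.lsmul ℝ ℝ, volume] Ω.indicator u) =
      (Ω.indicator u ⋆[ContinuousLinearMap.lsmul ℝ ℝ, volume] ρ.normed volume) := by
    rw [← convolution_flip]
    congr 1
    ext; simp
  have hUint : Integrable (Ω.indicator u) := hu.integrable_indicator hΩ.measurableSet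
  have hφ : ContDiff ℝ ∞ (fun z => ρ.normed volume (y - z)) :=
    ρ.contDiff_normed.comp (contDiff_const.sub contDiff_id)
  have hφts : tsupport (fun z => ρ.normed volume (y - z)) ⊆ Metric.closedBall y ρ.rOut := by
    refine closure_minimal (fun z hz => ?_) Metric.isClosed_closedBall
    have h1 : y - z ∈ Metric.ball (0 : 𝔼) ρ.rOut := by
      rw [← ρ.support_normed_eq (μ := volume)]; exact hz
    rw [mem_ball_zero_iff] at h1
    rw [Metric.mem_closedBall, dist_comm, dist_eq_norm]
    exact h1.le
  have hφc : HasCompactSupport (fun z => ρ.normed volume (y - z)) :=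
    (isCompact_closedBall y ρ.rOut).of_isClosed_subset (isClosed_tsupport _) hφts
  have hGi : IntegrableOn (fun z => ρ.normed volume (y - z) • G z) Ω := by
    have h2 : IntegrableOn G (tsupport fun z => ρ.normed volume (y - z)) :=
      hG.2.1.integrableOn_compact_subset (hφts.trans hy) hφc
    have h3 : IntegrableOn (fun z => ρ.normed volume (y - z) • G z)
        (tsupport fun z => ρ.normed volume (y - z)) :=
      h2.continuousOn_smul hφ.continuous.continuousOn hφc
    refine Integrable.integrableOn ((integrableOn_iff_integrable_of_support_subset ?_).1 h3)
    exact (Function.support_smul_subset_left (fun z => ρ.normed volume (y - z)) G).trans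
      subset_closure
  have hder : fderiv ℝ (ρ.normed volume ⋆[ContinuousLinearMap.lsmul ℝ ℝ, volume] Ω.indicator u) y =
      InnerProductSpace.toDual ℝ 𝔼 (∫ z in Ω, ρ.normed volume (y - z) • G z) := by
    rw [hcomm, (ρ.hasCompactSupport_normed.hasFDerivAt_convolution_right
      (ContinuousLinearMap.lsmul ℝ ℝ) hUint.locallyIntegrable
      (ρ.contDiff_normed (n := 1)) y).fderiv]
    have hce : ∀ i, ((Ω.indicator u) ⋆[(ContinuousLinearMap.lsmul ℝ ℝ).precompR 𝔼, volume]
          fderiv ℝ (ρ.normed volume)) y (EuclideanSpace.single i 1) =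
        ∫ z in Ω, G z i * ρ.normed volume (y - z) := by
      intro i
      rw [convolution_precompR_apply (ContinuousLinearMap.lsmul ℝ ℝ) hUint.locallyIntegrable
        (ρ.hasCompactSupport_normed.fderiv ℝ)
        ((ρ.contDiff_normed (n := 1)).continuous_fderiv one_ne_zero)]
      -- The weak gradient is tested against z ↦ ρ(y - z), which is supported in the closed ball
      -- inside Ω. The sign from integration by parts cancels the one from differentiating y - z.
      rw [← neg_neg (∫ z in Ω, G z i * ρ.normed volume (y - z)),
        ← hG.2.2 _ hφ hφc (hφts.trans hy) i, convolution_def, ← integral_neg,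
        ← integral_indicator hΩ.measurableSet]
      congr 1
      ext z
      have h4 : fderiv ℝ (fun z => ρ.normed volume (y - z)) z =
          -fderiv ℝ (ρ.normed volume) (y - z) := by
        have h5 := ((ρ.contDiff_normed (μ := volume) (n := 1)).differentiable one_ne_zero
          (y - z)).hasFDerivAt.comp z ((hasFDerivAt_id z).const_sub y)
        refine h5.fderiv.trans ?_
        ext; simp
      by_cases hz : z ∈ Ω <;> simp [hz, h4]
    have hb : ∀ w : 𝔼, w = ∑ i, w i • EuclideanSpace.single i (1 : ℝ) := by
      intro w; ext j; simp [Finset.sum_apply, Pi.single_apply]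
    ext w
    rw [hb w]
    simp only [map_sum, map_smul, hce]
    refine Finset.sum_congr rfl fun i _ => ?_
    congr 1
    rw [InnerProductSpace.toDual_apply_apply, EuclideanSpace.inner_single_right]
    have h5 := (EuclideanSpace.proj i : 𝔼 →L[ℝ] ℝ).integral_comp_comm hGi
    change ∫ z in Ω, ρ.normed volume (y - z) * G z i =
      (∫ z in Ω, ρ.normed volume (y - z) • G z) i at h5
    simp [← h5, mul_comm]
  have hn : ∀ w : 𝔼, ‖InnerProductSpace.toDual ℝ 𝔼 w‖ₑ = ‖w‖ₑ := fun w => by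
    simp [enorm_eq_nnnorm]
  rw [hder, hn]
  refine (enorm_integral_le_lintegral_enorm _).trans (le_of_eq ?_)
  simp [enorm_smul]

open scoped Convolution in
/-- Sobolev functions are approximated by smooth ones, uniformly on smaller balls where they are
continuous, without increasing the energy. -/
theorem exists_contDiff_approx {x : 𝔼} {r R q δ : ℝ} (hrR : r < R) (hq : 1 ≤ q) (hδ : 0 < δ)
    {u : 𝔼 → ℝ} {G : 𝔼 → 𝔼} (hu : IntegrableOn u (Metric.ball x R))
    (huc : ContinuousOn u (Metric.ball x R)) (hG : IsWeakGradient (Metric.ball x R) u G) :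
    ∃ f : 𝔼 → ℝ, ContDiff ℝ ∞ f ∧ (∀ y ∈ Metric.closedBall x r, |f y - u y| ≤ δ) ∧
      ∫⁻ y in Metric.closedBall x r, ‖fderiv ℝ f y‖ₑ ^ q ≤
        ∫⁻ y in Metric.ball x R, ‖G y‖ₑ ^ q := by
  set m := (r + R) / 2 with hm
  have hmR : m < R := by rw [hm]; linarith
  have hrm : r < m := by rw [hm]; linarith
  have huK : UniformContinuousOn u (Metric.closedBall x m) :=
    (isCompact_closedBall x m).uniformContinuousOn_of_continuous
      (huc.mono (Metric.closedBall_subset_ball hmR))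
  obtain ⟨η, hη, hηu⟩ := Metric.uniformContinuousOn_iff_le.1 huK δ hδ
  -- The radius η keeps the oscillation of u below δ, while m - r keeps the mollification at points
  -- of the r-ball inside the intermediate m-ball, where u is uniformly continuous.
  set ε := min η (m - r) with hε
  have hε0 : 0 < ε := lt_min hη (by linarith)
  let ρ : ContDiffBump (0 : 𝔼) := ⟨ε / 2, ε, half_pos hε0, half_lt_self hε0⟩
  have hUint : Integrable ((Metric.ball x R).indicator u) :=
    hu.integrable_indicator Metric.isOpen_ball.measurableSet
  refine ⟨ρ.normed volume ⋆[ContinuousLinearMap.lsmul ℝ ℝ, volume] (Metric.ball x R).indicator u,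
    ρ.hasCompactSupport_normed.contDiff_convolution_left _ ρ.contDiff_normed
      hUint.locallyIntegrable, fun y hy => ?_, ?_⟩
  · have hyR : y ∈ Metric.ball x R := Metric.closedBall_subset_ball (hrm.trans hmR) hy
    have h := ρ.dist_normed_convolution_le (μ := volume) (x₀ := y) (ε := δ)
      hUint.aestronglyMeasurable (fun z hz => ?_)
    · rwa [indicator_of_mem hyR, Real.dist_eq] at h
    · have hz1 : dist z y < ε := hz
      have hzm : z ∈ Metric.closedBall x m := by
        rw [Metric.mem_closedBall] at hy ⊢
        have := dist_triangle z y x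
        have := min_le_right η (m - r)
        linarith
      rw [indicator_of_mem hyR, indicator_of_mem (Metric.closedBall_subset_ball hmR hzm)]
      exact hηu z hzm y (Metric.closedBall_subset_closedBall hrm.le hy)
        (hz1.le.trans (min_le_left _ _))
  -- The kernel has mass one in either variable: once for Jensen at fixed y, once after Tonelli. So
  -- the energy does not grow.
  · have hk1 : ∀ y : 𝔼, ∫⁻ z, ‖ρ.normed volume (y - z)‖ₑ = 1 := by
      intro y
      rw [lintegral_sub_left_eq_self (fun z => ‖ρ.normed volume z‖ₑ) y]
      have h1 : ∫⁻ z, ‖ρ.normed volume z‖ₑ ∂(volume : Measure 𝔼) =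
          ENNReal.ofReal (∫ z, ρ.normed volume z) := by
        rw [ofReal_integral_eq_lintegral_ofReal ρ.integrable_normed
          (Eventually.of_forall ρ.nonneg_normed)]
        exact lintegral_congr fun z => Real.enorm_of_nonneg (ρ.nonneg_normed z)
      rw [h1, ρ.integral_normed, ENNReal.ofReal_one]
    have hGm : AEMeasurable (fun z => (Metric.ball x R).indicator (fun z => ‖G z‖ₑ) z) := by
      rw [aemeasurable_indicator_iff Metric.isOpen_ball.measurableSet]
      exact hG.2.1.aestronglyMeasurable.enorm
    have hkm : ∀ y : 𝔼, Measurable fun z => ‖ρ.normed volume (y - z)‖ₑ := fun y =>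
      (ρ.continuous_normed.comp (continuous_const.sub continuous_id)).enorm.measurable
    have hpt : ∀ y ∈ Metric.closedBall x r, ‖fderiv ℝ (ρ.normed volume
          ⋆[ContinuousLinearMap.lsmul ℝ ℝ, volume] (Metric.ball x R).indicator u) y‖ₑ ^ q ≤
        ∫⁻ z, ‖ρ.normed volume (y - z)‖ₑ *
          ((Metric.ball x R).indicator (fun z => ‖G z‖ₑ) z) ^ q := by
      intro y hy
      refine le_trans (ENNReal.rpow_le_rpow ?_ (by linarith))
        (lintegral_mul_rpow_le hq (hkm y).aemeasurable (hk1 y) hGm)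
      refine (enorm_fderiv_convolution_le Metric.isOpen_ball hu hG ρ ?_).trans (le_of_eq ?_)
      · refine (Metric.closedBall_subset_closedBall' (ε₂ := m) ?_).trans
          (Metric.closedBall_subset_ball hmR)
        rw [Metric.mem_closedBall] at hy
        have := min_le_right η (m - r)
        change ε + dist y x ≤ m
        linarith
      · rw [← lintegral_indicator Metric.isOpen_ball.measurableSet]
        refine lintegral_congr fun z => ?_
        by_cases hz : z ∈ Metric.ball x R <;> simp only [indicator_of_mem, indicator_of_notMem, hz,
          not_false_eq_true, mul_zero]
    calc _ ≤ ∫⁻ y in Metric.closedBall x r, ∫⁻ z, ‖ρ.normed volume (y - z)‖ₑ *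
          ((Metric.ball x R).indicator (fun z => ‖G z‖ₑ) z) ^ q :=
        setLIntegral_mono' measurableSet_closedBall hpt
      _ ≤ ∫⁻ y, ∫⁻ z, ‖ρ.normed volume (y - z)‖ₑ *
          ((Metric.ball x R).indicator (fun z => ‖G z‖ₑ) z) ^ q := setLIntegral_le_lintegral _ _
      _ = ∫⁻ z, ∫⁻ y, ‖ρ.normed volume (y - z)‖ₑ *
          ((Metric.ball x R).indicator (fun z => ‖G z‖ₑ) z) ^ q := by
        rw [lintegral_lintegral_swap]
        refine AEMeasurable.mul (Measurable.aemeasurable ?_) ?_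
        · exact (ρ.continuous_normed.comp (continuous_fst.sub continuous_snd)).enorm.measurable
        · exact (hGm.pow_const q).comp_quasiMeasurePreserving
            Measure.quasiMeasurePreserving_snd
      _ = ∫⁻ z, ((Metric.ball x R).indicator (fun z => ‖G z‖ₑ) z) ^ q := by
        refine lintegral_congr fun z => ?_
        have hkm' : Measurable fun y => ‖ρ.normed volume (y - z)‖ₑ :=
          (ρ.continuous_normed.comp (continuous_id.sub continuous_const)).enorm.measurable
        rw [lintegral_mul_const _ hkm',
          lintegral_sub_right_eq_self (fun y => ‖ρ.normed volume y‖ₑ) z]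
        have h2 := hk1 0
        rw [lintegral_sub_left_eq_self (fun z => ‖ρ.normed volume z‖ₑ) (0 : 𝔼)] at h2
        rw [h2, one_mul]
      _ = _ := by
        rw [← lintegral_indicator Metric.isOpen_ball.measurableSet]
        refine lintegral_congr fun z => ?_
        have hq0 : 0 < q := by linarith
        by_cases hz : z ∈ Metric.ball x R <;> simp only [indicator_of_mem, indicator_of_notMem, hz,
          not_false_eq_true, ENNReal.zero_rpow_of_pos hq0]

/-! ### Reduction of capacities to smooth test functions -/

/-- A smooth step function with bounded derivative. -/
theorem exists_smooth_step : ∃ ψ : ℝ → ℝ, ContDiff ℝ ∞ ψ ∧ (∀ s ≤ 1 / 4, ψ s = 0) ∧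
    (∀ s, 3 / 4 ≤ s → ψ s = 1) ∧ ∃ M : NNReal, M ≠ 0 ∧ ∀ s, ‖fderiv ℝ ψ s‖ₑ ≤ M := by
  have hψ : ContDiff ℝ ∞ fun s : ℝ => Real.smoothTransition (2 * s - 1 / 2) :=
    Real.smoothTransition.contDiff.comp (by fun_prop)
  have h0 : ∀ s : ℝ, s ≤ 1 / 4 → Real.smoothTransition (2 * s - 1 / 2) = 0 := fun s hs =>
    Real.smoothTransition.zero_of_nonpos (by linarith)
  have h1 : ∀ s : ℝ, 3 / 4 ≤ s → Real.smoothTransition (2 * s - 1 / 2) = 1 := fun s hs =>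
    Real.smoothTransition.one_of_one_le (by linarith)
  refine ⟨_, hψ, h0, h1, ?_⟩
  have hc : HasCompactSupport (fderiv ℝ fun s : ℝ => Real.smoothTransition (2 * s - 1 / 2)) := by
    refine HasCompactSupport.intro (isCompact_Icc (a := (0 : ℝ)) (b := 1)) fun s hs => ?_
    rw [mem_Icc, not_and_or, not_le, not_le] at hs
    rcases hs with hs | hs
    · have : (fun s : ℝ => Real.smoothTransition (2 * s - 1 / 2)) =ᶠ[𝓝 s] fun _ => 0 := by
        filter_upwards [Iio_mem_nhds hs] with a ha using h0 a (by linarith [mem_Iio.1 ha])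
      rw [this.fderiv_eq]; simp
    · have : (fun s : ℝ => Real.smoothTransition (2 * s - 1 / 2)) =ᶠ[𝓝 s] fun _ => 1 := by
        filter_upwards [Ioi_mem_nhds hs] with a ha using h1 a (by linarith [mem_Ioi.1 ha])
      rw [this.fderiv_eq]; simp
  obtain ⟨M, hM⟩ := (hψ.continuous_fderiv (by simp)).bounded_above_of_compact_support hc
  refine ⟨(max M 1).toNNReal, ?_, fun s => ?_⟩
  · simp
  · rw [← ofReal_norm]
    exact ENNReal.ofReal_le_ofReal ((hM s).trans (le_max_left _ _))

theorem integrableOn_of_memSobolev {q : ℝ} (hq : 1 ≤ q) {x : 𝔼} {r : ℝ} {u : 𝔼 → ℝ}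
    (hu : MemSobolev q (Metric.ball x r) u) : IntegrableOn u (Metric.ball x r) := by
  have : IsFiniteMeasure (volume.restrict (Metric.ball x r)) :=
    ⟨by simpa using measure_ball_lt_top⟩
  exact hu.1.integrable (by simpa using ENNReal.ofReal_le_ofReal hq)

/-- The class of smooth test functions equal to `1` on `S` and vanishing off `B(x, 2t)`. -/
structure IsTestFunction (S : Set (EuclideanSpace ℝ (Fin n))) (x : EuclideanSpace ℝ (Fin n))
    (t : ℝ) (v : EuclideanSpace ℝ (Fin n) → ℝ) : Prop where
  contDiff : ContDiff ℝ ∞ v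
  eq_one : ∀ y ∈ S, v y = 1
  eq_zero : ∀ y, 2 * t ≤ dist y x → v y = 0

theorem IsTestFunction.hasCompactSupport {S : Set 𝔼} {x : 𝔼} {t : ℝ} {v : 𝔼 → ℝ}
    (hv : IsTestFunction S x t v) : HasCompactSupport v :=
  HasCompactSupport.intro (isCompact_closedBall x (2 * t)) fun y hy =>
    hv.eq_zero y (by rw [Metric.mem_closedBall, not_le] at hy; exact hy.le)

/-- All upper bounds for capacities below pass through this form, where T may be the whole annulus
or only its part inside a given set. -/
theorem IsTestFunction.capacity_le {S T Ω : Set 𝔼} {x : 𝔼} {t q : ℝ} {v : 𝔼 → ℝ}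
    (hv : IsTestFunction S x t v) (hT : ∀ y ∈ T, 2 * t ≤ dist y x) :
    capacity q S T Ω ≤ ∫⁻ y, ‖fderiv ℝ v y‖ₑ ^ q :=
  capacity_le_of_contDiff hv.contDiff hv.hasCompactSupport (fun y hy => (hv.eq_one y hy).ge)
    fun y hy => (hv.eq_zero y (hT y hy)).le

/-- Admissible functions may be replaced by smooth ones at the cost of a constant factor. -/
theorem exists_isTestFunction : ∃ M : NNReal, M ≠ 0 ∧
    ∀ (x : 𝔼) (t q : ℝ) (S : Set 𝔼), 0 < t → 1 ≤ q → S ⊆ Metric.ball x t →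
      ∀ u ∈ admissible q S (annulus x (2 * t) (3 * t)) (Metric.ball x (4 * t)),
      ∀ G, IsWeakGradient (Metric.ball x (4 * t)) u G →
        ∃ v, IsTestFunction S x t v ∧
          ∫⁻ y, ‖fderiv ℝ v y‖ₑ ^ q ≤
            (M : ℝ≥0∞) ^ q * ∫⁻ y in Metric.ball x (4 * t), ‖G y‖ₑ ^ q := by
  obtain ⟨ψ, hψ, hψ0, hψ1, M, hM0, hM⟩ := exists_smooth_step
  refine ⟨M, hM0, fun x t q S ht hq hS u hu G hG => ?_⟩
  -- With error at most 1/4, f is at least 3/4 on S and at most 1/4 on the zero annulus, exactly the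
  -- thresholds beyond which the step ψ is constant.
  obtain ⟨f, hf, hfu, hfG⟩ := exists_contDiff_approx (x := x) (r := 5 / 2 * t) (R := 4 * t)
    (δ := 1 / 4) (by linarith) hq (by norm_num) (integrableOn_of_memSobolev hq hu.1)
    (hu.2.1.mono fun y hy => Or.inl (Or.inl hy)) hG
  -- The cutoff falls from 1 to 0 only for 9t/4 ≤ |y - x| ≤ 5t/2, where ψ ∘ f already vanishes. Its
  -- derivative thus never enters, and the only loss is the bound M for ψ'.
  let χ : ContDiffBump x := ⟨9 / 4 * t, 5 / 2 * t, by linarith, by linarith⟩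
  have hv0 : ∀ y, 2 * t ≤ dist y x → χ y * ψ (f y) = 0 := by
    intro y hy
    by_cases h : 5 / 2 * t ≤ dist y x
    · rw [χ.zero_of_le_dist h, zero_mul]
    · push Not at h
      have hya : y ∈ annulus x (2 * t) (3 * t) :=
        ⟨Metric.mem_ball.2 (by linarith), fun h' => absurd (Metric.mem_ball.1 h') (by linarith)⟩
      have h1 := hu.2.2.2 y hya
      have h2 := (abs_le.1 (hfu y (Metric.mem_closedBall.2 h.le))).2
      rw [hψ0 _ (by linarith), mul_zero]
  have hder : ∀ y, ‖fderiv ℝ (fun y => χ y * ψ (f y)) y‖ₑ ≤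
      (Metric.closedBall x (5 / 2 * t)).indicator (fun y => M * ‖fderiv ℝ f y‖ₑ) y := by
    intro y
    by_cases hy : 2 * t < dist y x
    · have : (fun y => χ y * ψ (f y)) =ᶠ[𝓝 y] fun _ => 0 := by
        filter_upwards [(isOpen_lt continuous_const (continuous_id.dist continuous_const)).mem_nhds
          hy] with z hz using hv0 z (le_of_lt hz)
      rw [this.fderiv_eq, fderiv_fun_const]
      rw [Pi.zero_apply, ← ofReal_norm, norm_zero, ENNReal.ofReal_zero]
      exact bot_le
    · push Not at hy
      have : (fun y => χ y * ψ (f y)) =ᶠ[𝓝 y] ψ ∘ f := by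
        filter_upwards [Metric.isOpen_ball.mem_nhds (show y ∈ Metric.ball x (9 / 4 * t) from
          Metric.mem_ball.2 (by linarith))] with z hz
        rw [χ.one_of_mem_closedBall (Metric.ball_subset_closedBall hz), one_mul, Function.comp]
      rw [this.fderiv_eq, indicator_of_mem (Metric.mem_closedBall.2 (by linarith)),
        fderiv_comp y (hψ.differentiable (by simp) _) (hf.differentiable (by simp) _)]
      exact (ContinuousLinearMap.opENorm_comp_le _ _).trans (by gcongr; exact hM _)
  refine ⟨fun y => χ y * ψ (f y), ⟨χ.contDiff.mul (hψ.comp hf), fun y hy => ?_, hv0⟩, ?_⟩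
  · have hyt := Metric.mem_ball.1 (hS hy)
    have h1 := hu.2.2.1 y hy
    have h2 := (abs_le.1 (hfu y (Metric.mem_closedBall.2 (by linarith)))).1
    rw [χ.one_of_mem_closedBall (Metric.mem_closedBall.2 (by change _ ≤ 9 / 4 * t; linarith)),
      hψ1 _ (by linarith), one_mul]
  · have hq0 : 0 < q := by linarith
    calc _ ≤ ∫⁻ y, (Metric.closedBall x (5 / 2 * t)).indicator
          (fun y => (M : ℝ≥0∞) ^ q * ‖fderiv ℝ f y‖ₑ ^ q) y := by
          refine lintegral_mono fun y => (ENNReal.rpow_le_rpow (hder y) hq0.le).trans (le_of_eq ?_)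
          by_cases hy : y ∈ Metric.closedBall x (5 / 2 * t) <;>
            simp only [indicator_of_mem, indicator_of_notMem, hy, not_false_eq_true,
              ENNReal.zero_rpow_of_pos hq0, ENNReal.mul_rpow_of_nonneg _ _ hq0.le]
      _ = (M : ℝ≥0∞) ^ q * ∫⁻ y in Metric.closedBall x (5 / 2 * t), ‖fderiv ℝ f y‖ₑ ^ q := by
          rw [lintegral_indicator measurableSet_closedBall, lintegral_const_mul']
          exact ENNReal.rpow_ne_top_of_nonneg hq0.le ENNReal.coe_ne_top
      _ ≤ _ := by gcongr

/-- A lower bound for the energy of test functions gives a lower bound for the capacity. -/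
theorem exists_le_mul_capacity (n : ℕ) : ∃ M : NNReal, M ≠ 0 ∧
    ∀ (x : EuclideanSpace ℝ (Fin n)) (t q : ℝ) (S : Set (EuclideanSpace ℝ (Fin n))) (a K : ℝ≥0∞),
      0 < t → 1 ≤ q → S ⊆ Metric.ball x t → K ≠ 0 → K ≠ ⊤ →
      (∀ v, IsTestFunction S x t v → a ≤ K * ∫⁻ y, ‖fderiv ℝ v y‖ₑ ^ q) →
        a ≤ K * (M : ℝ≥0∞) ^ q *
          capacity q S (annulus x (2 * t) (3 * t)) (Metric.ball x (4 * t)) := by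
  obtain ⟨M, hM0, hM⟩ := exists_isTestFunction (n := n)
  refine ⟨M, hM0, fun x t q S a K ht hq hS hK0 hK h => ?_⟩
  have hMq0 : (M : ℝ≥0∞) ^ q ≠ 0 := by
    simp [ENNReal.rpow_eq_zero_iff, hM0]
  have hMq : (M : ℝ≥0∞) ^ q ≠ ⊤ :=
    ENNReal.rpow_ne_top_of_nonneg (by linarith) ENNReal.coe_ne_top
  -- Dividing by the finite nonzero constant isolates the capacity, so that the bound can be checked
  -- for each competitor in the infimum.
  rw [mul_comm, ← ENNReal.div_le_iff (mul_ne_zero hK0 hMq0) (ENNReal.mul_ne_top hK hMq)]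
  refine le_iInf₂ fun u hu => le_iInf₂ fun G hG => ?_
  rw [ENNReal.div_le_iff (mul_ne_zero hK0 hMq0) (ENNReal.mul_ne_top hK hMq), mul_comm, mul_assoc]
  obtain ⟨v, hv, hvG⟩ := hM x t q S ht hq hS u hu G hG
  exact (h v hv).trans (by gcongr)

/-! ### Volume bounds, scaling and the capacity of balls -/

/-- The measure of a set is controlled by its capacity. -/
theorem exists_volume_le_mul_capacity (n : ℕ) (hn : 0 < n) (q : ℝ) (hq : 1 ≤ q) :
    ∃ M : NNReal, M ≠ 0 ∧
    ∀ (x : EuclideanSpace ℝ (Fin n)) (t : ℝ) (S : Set (EuclideanSpace ℝ (Fin n))),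
      0 < t → S ⊆ Metric.ball x t →
        volume S ≤ ENNReal.ofReal t ^ q * M *
          capacity q S (annulus x (2 * t) (3 * t)) (Metric.ball x (4 * t)) := by
  have : Nonempty (Fin n) := ⟨⟨0, hn⟩⟩
  have hq0 : 0 < q := by linarith
  obtain ⟨M, hM0, hM⟩ := exists_le_mul_capacity n
  refine ⟨(4 * M) ^ q, ?_, fun x t S ht hS => ?_⟩
  · simp [NNReal.rpow_eq_zero_iff, hM0]
  have hK0 : ENNReal.ofReal (4 * t) ^ q ≠ 0 := by
    have : 0 < 4 * t := by linarith
    simp [ENNReal.rpow_eq_zero_iff, ht, hq0.not_gt]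
  have hK : ENNReal.ofReal (4 * t) ^ q ≠ ⊤ :=
    ENNReal.rpow_ne_top_of_nonneg hq0.le ENNReal.ofReal_ne_top
  refine (hM x t q S _ _ ht hq hS hK0 hK fun v hv => ?_).trans (le_of_eq ?_)
  -- Since v = 1 on S, Chebyshev's inequality at level 1 bounds |S| by ∫|v|^q, and the Poincaré
  -- inequality bounds this by the energy.
  · refine le_trans ?_ (lintegral_rpow_le_of_support volume hv.contDiff ht hq hv.eq_zero)
    have hmv : AEMeasurable (fun y => ‖v y‖ₑ ^ q) :=
      (hv.contDiff.continuous.enorm.measurable.pow_const q).aemeasurable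
    have h1 := mul_meas_ge_le_lintegral₀ (μ := volume) hmv 1
    rw [one_mul] at h1
    refine (measure_mono fun y hy => ?_).trans h1
    simp [hv.eq_one y hy]
  · rw [ENNReal.coe_rpow_of_nonneg _ hq0.le, ENNReal.ofReal_mul (by norm_num),
      ENNReal.coe_mul, ENNReal.mul_rpow_of_nonneg _ _ hq0.le, ENNReal.mul_rpow_of_nonneg _ _ hq0.le]
    simp only [ENNReal.ofReal_ofNat, ENNReal.coe_ofNat]
    ring

theorem fderiv_comp_dilation {F : 𝔼 → ℝ} (hF : ContDiff ℝ ∞ F) (x : 𝔼) (s : ℝ) (y : 𝔼) :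
    fderiv ℝ (fun y => F (s • (y - x))) y = s • fderiv ℝ F (s • (y - x)) := by
  have h1 : HasFDerivAt (fun y : 𝔼 => s • (y - x)) (s • ContinuousLinearMap.id ℝ 𝔼) y :=
    ((hasFDerivAt_id y).sub_const x).const_smul s
  have h2 := (hF.differentiable (by simp) (s • (y - x))).hasFDerivAt.comp y h1
  refine h2.fderiv.trans ?_
  ext; simp

/-- Lets one fixed function at unit scale serve all centres and scales, which makes the constants
uniform in x and t. -/
theorem IsTestFunction.dilation {F : 𝔼 → ℝ} {S₀ S : Set 𝔼} (hF : IsTestFunction S₀ 0 1 F)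
    {x : 𝔼} {t : ℝ} (ht : 0 < t) (hS : ∀ y ∈ S, t⁻¹ • (y - x) ∈ S₀) :
    IsTestFunction S x t fun y => F (t⁻¹ • (y - x)) where
  contDiff := hF.contDiff.comp (f := fun y => t⁻¹ • (y - x)) (by fun_prop)
  eq_one y hy := hF.eq_one _ (hS y hy)
  eq_zero y hy := by
    refine hF.eq_zero _ ?_
    rw [dist_zero_right, norm_smul, norm_inv, Real.norm_of_nonneg ht.le, ← dist_eq_norm,
      le_inv_mul_iff₀ ht]
    linarith

/-- Scaling of the energy. -/
theorem lintegral_fderiv_dilation {F : 𝔼 → ℝ} (hF : ContDiff ℝ ∞ F) (x : 𝔼) {t q : ℝ}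
    (ht : 0 < t) (hq : 0 ≤ q) :
    ∫⁻ y, ‖fderiv ℝ (fun y => F (t⁻¹ • (y - x))) y‖ₑ ^ q =
      ENNReal.ofReal t ^ n * (ENNReal.ofReal t ^ q)⁻¹ * ∫⁻ y, ‖fderiv ℝ F y‖ₑ ^ q := by
  have hcont : Continuous (fderiv ℝ F) := hF.continuous_fderiv (by simp)
  have hm : Measurable fun y => ‖fderiv ℝ F y‖ₑ ^ q := hcont.enorm.measurable.pow_const q
  have hs : ‖t⁻¹‖ₑ ^ q = (ENNReal.ofReal t ^ q)⁻¹ := by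
    rw [Real.enorm_of_nonneg (by positivity), ENNReal.ofReal_inv_of_pos ht, ENNReal.inv_rpow]
  have hs' : (ENNReal.ofReal t ^ q)⁻¹ ≠ ⊤ := by
    rw [← hs]; exact ENNReal.rpow_ne_top_of_nonneg hq enorm_ne_top
  simp only [fderiv_comp_dilation hF, enorm_smul, ENNReal.mul_rpow_of_nonneg _ _ hq, hs]
  rw [lintegral_const_mul' _ _ hs',
    lintegral_sub_right_eq_self (fun y => ‖fderiv ℝ F (t⁻¹ • y)‖ₑ ^ q) x]
  have hmap := Measure.map_addHaar_smul (volume : Measure 𝔼) (inv_ne_zero ht.ne')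
  have h1 : ∫⁻ y, ‖fderiv ℝ F (t⁻¹ • y)‖ₑ ^ q =
      ∫⁻ y, ‖fderiv ℝ F y‖ₑ ^ q ∂(Measure.map (fun y : 𝔼 => t⁻¹ • y) volume) :=
    (lintegral_map hm (measurable_const_smul _)).symm
  rw [h1, show (fun y : 𝔼 => t⁻¹ • y) = (t⁻¹ • ·) from rfl, hmap, lintegral_smul_measure]
  have h2 : ENNReal.ofReal |(t⁻¹ ^ Module.finrank ℝ 𝔼)⁻¹| = ENNReal.ofReal t ^ n := by
    rw [finrank_euclideanSpace_fin, inv_pow, inv_inv, abs_of_pos (by positivity),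
      ENNReal.ofReal_pow ht.le]
  rw [h2, smul_eq_mul]
  ring

/-- A smooth cutoff function with bounded derivative. -/
theorem exists_cutoff (n : ℕ) : ∃ F : EuclideanSpace ℝ (Fin n) → ℝ,
    IsTestFunction (Metric.closedBall 0 1) 0 1 F ∧ (∀ y, ‖F y‖ₑ ≤ 1) ∧
      ∃ K : NNReal, ∀ y, ‖fderiv ℝ F y‖ₑ ≤ K := by
  let b : ContDiffBump (0 : EuclideanSpace ℝ (Fin n)) := ⟨1, 2, one_pos, one_lt_two⟩
  have hb : ContDiff ℝ ∞ b := b.contDiff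
  refine ⟨b, ⟨hb, fun y hy => b.one_of_mem_closedBall hy,
    fun y hy => b.zero_of_le_dist (by simpa using hy)⟩, fun y => ?_, ?_⟩
  · rw [Real.enorm_of_nonneg b.nonneg]
    exact ENNReal.ofReal_le_one.2 b.le_one
  · obtain ⟨K, hK⟩ := (hb.continuous_fderiv (by simp)).bounded_above_of_compact_support
      (b.hasCompactSupport.fderiv ℝ)
    refine ⟨K.toNNReal, fun y => ?_⟩
    rw [← ofReal_norm]
    exact ENNReal.ofReal_le_ofReal (hK y)

theorem IsTestFunction.lintegral_ne_top {S : Set 𝔼} {x : 𝔼} {t q : ℝ} {v : 𝔼 → ℝ}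
    (hv : IsTestFunction S x t v) (hq : 0 < q) : ∫⁻ y, ‖fderiv ℝ v y‖ₑ ^ q ≠ ⊤ := by
  have h : MemLp (fderiv ℝ v) (ENNReal.ofReal q) volume :=
    (hv.contDiff.continuous_fderiv (by simp)).memLp_of_hasCompactSupport
      (hv.hasCompactSupport.fderiv ℝ)
  have h2 := lintegral_rpow_enorm_lt_top_of_eLpNorm_lt_top (by simpa using hq)
    ENNReal.ofReal_ne_top h.2
  rw [ENNReal.toReal_ofReal hq.le] at h2
  exact h2.ne

theorem ofReal_rpow_ne_zero {t : ℝ} (ht : 0 < t) (q : ℝ) : ENNReal.ofReal t ^ q ≠ 0 := by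
  rw [ENNReal.ofReal_rpow_of_pos ht]
  simpa using Real.rpow_pos_of_pos ht q

theorem ofReal_rpow_ne_top {t : ℝ} (ht : 0 < t) (q : ℝ) : ENNReal.ofReal t ^ q ≠ ⊤ := by
  rw [ENNReal.ofReal_rpow_of_pos ht]
  exact ENNReal.ofReal_ne_top

/-- Upper bound for the capacity of a ball. -/
theorem exists_capacity_ball_le (n : ℕ) {q : ℝ} (hq : 0 < q) : ∃ A : NNReal,
    ∀ (x : EuclideanSpace ℝ (Fin n)) (t : ℝ), 0 < t →
      capacity q (Metric.ball x t) (annulus x (2 * t) (3 * t)) (Metric.ball x (4 * t)) ≤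
        ENNReal.ofReal t ^ n * (ENNReal.ofReal t ^ q)⁻¹ * A := by
  obtain ⟨F, hF, -⟩ := exists_cutoff n
  refine ⟨(∫⁻ y, ‖fderiv ℝ F y‖ₑ ^ q).toNNReal, fun x t ht => ?_⟩
  rw [ENNReal.coe_toNNReal (hF.lintegral_ne_top hq), ← lintegral_fderiv_dilation hF.contDiff x ht
    hq.le]
  refine (hF.dilation (S := Metric.ball x t) ht fun y hy => ?_).capacity_le fun y hy => ?_
  · rw [mem_closedBall_zero_iff, norm_smul, norm_inv, Real.norm_of_nonneg ht.le, ← dist_eq_norm,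
      inv_mul_le_iff₀ ht]
    linarith [Metric.mem_ball.1 hy]
  · simpa using hy.2

/-- Lower bound for the capacity of a ball. -/
theorem exists_le_capacity_ball (n : ℕ) (hn : 0 < n) {q : ℝ} (hq : 1 ≤ q) : ∃ B : NNReal,
    ∀ (x : EuclideanSpace ℝ (Fin n)) (t : ℝ), 0 < t →
      ENNReal.ofReal t ^ n * (ENNReal.ofReal t ^ q)⁻¹ ≤ B *
        capacity q (Metric.ball x t) (annulus x (2 * t) (3 * t)) (Metric.ball x (4 * t)) := by
  obtain ⟨M, hM0, hM⟩ := exists_volume_le_mul_capacity n hn q hq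
  set c₁ := volume (Metric.ball (0 : EuclideanSpace ℝ (Fin n)) 1) with hc
  have hc0 : c₁ ≠ 0 := (Metric.measure_ball_pos _ _ one_pos).ne'
  have hct : c₁ ≠ ⊤ := measure_ball_lt_top.ne
  refine ⟨M * c₁.toNNReal⁻¹, fun x t ht => ?_⟩
  have h := hM x t _ ht subset_rfl
  rw [Measure.addHaar_ball_of_pos _ _ ht, finrank_euclideanSpace_fin, ← hc,
    ENNReal.ofReal_pow ht.le] at h
  have hcc : c₁.toNNReal ≠ 0 := by simp [ENNReal.toNNReal_eq_zero_iff, hc0, hct]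
  rw [ENNReal.coe_mul, ENNReal.coe_inv hcc, ENNReal.coe_toNNReal hct, ← div_eq_mul_inv,
    ENNReal.div_le_iff (ofReal_rpow_ne_zero ht q) (ofReal_rpow_ne_top ht q)]
  rw [← ENNReal.le_div_iff_mul_le (Or.inl hc0) (Or.inl hct), div_eq_mul_inv] at h
  refine h.trans (le_of_eq ?_)
  ring

/-! ### Comparison of capacities at neighbouring scales -/

theorem enorm_clm_add_le (a b : 𝔼 →L[ℝ] ℝ) : ‖a + b‖ₑ ≤ ‖a‖ₑ + ‖b‖ₑ :=
  enorm_add_le a b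

/-- Capacities at comparable scales are comparable. -/
theorem exists_capacity_inter_ball_le (n : ℕ) (hn : 0 < n) {q : ℝ} (hq : 1 ≤ q) : ∃ C : NNReal,
    ∀ (E : Set (EuclideanSpace ℝ (Fin n))) (x : EuclideanSpace ℝ (Fin n)) (s t : ℝ),
      0 < s → s ≤ t → t ≤ 2 * s →
      capacity q (E ∩ Metric.ball x s) (annulus x (2 * s) (3 * s)) (Metric.ball x (4 * s)) ≤ C *
        capacity q (E ∩ Metric.ball x t) (annulus x (2 * t) (3 * t)) (Metric.ball x (4 * t)) := by
  have : Nonempty (Fin n) := ⟨⟨0, hn⟩⟩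
  have hq0 : 0 < q := by linarith
  obtain ⟨M, hM0, hM⟩ := exists_le_mul_capacity n
  obtain ⟨F, hF, hF1, K, hK⟩ := exists_cutoff n
  -- A test function v at scale t is cut off at scale s. The cutoff has derivative at most K/s, and
  -- the Poincaré factor is 4t ≤ 8s, whence 8K; the power of 2 comes from (a + b)^q.
  set C₀ : ℝ≥0∞ := 2 ^ (q - 1) * (1 + (8 * K) ^ q) with hC₀
  have h2 : (2 : ℝ≥0∞) ^ (q - 1) ≠ ⊤ :=
    ENNReal.rpow_ne_top_of_nonneg (by linarith) ENNReal.ofNat_ne_top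
  have h2' : (2 : ℝ≥0∞) ^ (q - 1) ≠ 0 := by
    simp [ENNReal.rpow_eq_zero_iff]
  have hC₀t : C₀ ≠ ⊤ := by
    refine ENNReal.mul_ne_top h2 (ENNReal.add_ne_top.2 ⟨ENNReal.one_ne_top, ?_⟩)
    exact ENNReal.rpow_ne_top_of_nonneg hq0.le
      (ENNReal.mul_ne_top ENNReal.ofNat_ne_top ENNReal.coe_ne_top)
  have hC₀0 : C₀ ≠ 0 := mul_ne_zero h2' (by simp)
  have hMq : (M : ℝ≥0∞) ^ q ≠ ⊤ :=
    ENNReal.rpow_ne_top_of_nonneg hq0.le ENNReal.coe_ne_top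
  refine ⟨(C₀ * (M : ℝ≥0∞) ^ q).toNNReal, fun E x s t hs hst hts => ?_⟩
  have ht : 0 < t := by linarith
  rw [ENNReal.coe_toNNReal (ENNReal.mul_ne_top hC₀t hMq)]
  refine hM x t q _ _ _ ht hq inter_subset_right hC₀0 hC₀t fun v hv => ?_
  have hχ := hF.dilation (S := Metric.ball x s) (x := x) hs fun y hy => by
    rw [mem_closedBall_zero_iff, norm_smul, norm_inv, Real.norm_of_nonneg hs.le, ← dist_eq_norm,
      inv_mul_le_iff₀ hs]
    linarith [Metric.mem_ball.1 hy]
  set χ := fun y => F (s⁻¹ • (y - x)) with hχdef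
  have hχv : IsTestFunction (E ∩ Metric.ball x s) x s (fun y => χ y * v y) :=
    ⟨hχ.contDiff.mul hv.contDiff, fun y hy => by
      rw [hχ.eq_one y hy.2, hv.eq_one y ⟨hy.1, Metric.ball_subset_ball hst hy.2⟩, one_mul],
      fun y hy => by rw [hχ.eq_zero y hy, zero_mul]⟩
  refine (hχv.capacity_le fun y hy => by simpa using hy.2).trans ?_
  have hpt : ∀ y, ‖fderiv ℝ (fun y => χ y * v y) y‖ₑ ^ q ≤ 2 ^ (q - 1) *
      (‖fderiv ℝ v y‖ₑ ^ q + (ENNReal.ofReal s⁻¹ * K) ^ q * ‖v y‖ₑ ^ q) := by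
    intro y
    have h1 : ‖fderiv ℝ (fun y => χ y * v y) y‖ₑ ≤
        ‖fderiv ℝ v y‖ₑ + ENNReal.ofReal s⁻¹ * K * ‖v y‖ₑ := by
      rw [fderiv_fun_mul (hχ.contDiff.differentiable (by simp) y)
        (hv.contDiff.differentiable (by simp) y)]
      refine (enorm_clm_add_le _ _).trans ?_
      rw [enorm_smul, enorm_smul, hχdef, fderiv_comp_dilation hF.contDiff, enorm_smul,
        Real.enorm_of_nonneg (inv_pos.2 hs).le]
      refine add_le_add (mul_le_of_le_one_left' (hF1 _)) ?_
      rw [mul_comm]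
      gcongr
      exact hK _
    refine (ENNReal.rpow_le_rpow h1 hq0.le).trans
      ((ENNReal.rpow_add_le_mul_rpow_add_rpow _ _ hq).trans (le_of_eq ?_))
    rw [ENNReal.mul_rpow_of_nonneg _ ‖v y‖ₑ hq0.le]
  have hcont : Continuous (fderiv ℝ v) := hv.contDiff.continuous_fderiv (by simp)
  have hm : Measurable fun y => ‖fderiv ℝ v y‖ₑ ^ q := hcont.enorm.measurable.pow_const q
  have hsK : (ENNReal.ofReal s⁻¹ * K) ^ q ≠ ⊤ := ENNReal.rpow_ne_top_of_nonneg hq0.le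
    (ENNReal.mul_ne_top ENNReal.ofReal_ne_top ENNReal.coe_ne_top)
  calc _ ≤ _ := lintegral_mono hpt
    _ = 2 ^ (q - 1) * ((∫⁻ y, ‖fderiv ℝ v y‖ₑ ^ q) +
        (ENNReal.ofReal s⁻¹ * K) ^ q * ∫⁻ y, ‖v y‖ₑ ^ q) := by
      rw [lintegral_const_mul' _ _ h2, lintegral_add_left hm, lintegral_const_mul' _ _ hsK]
    _ ≤ 2 ^ (q - 1) * ((∫⁻ y, ‖fderiv ℝ v y‖ₑ ^ q) +
        (8 * K) ^ q * ∫⁻ y, ‖fderiv ℝ v y‖ₑ ^ q) := by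
      gcongr 2 ^ (q - 1) * (_ + ?_)
      refine (mul_le_mul_right (lintegral_rpow_le_of_support volume hv.contDiff ht hq hv.eq_zero)
        _).trans ?_
      rw [← mul_assoc, ← ENNReal.mul_rpow_of_nonneg _ _ hq0.le]
      refine mul_le_mul_left (ENNReal.rpow_le_rpow ?_ hq0.le) _
      rw [mul_right_comm, ← ENNReal.ofReal_mul (inv_pos.2 hs).le]
      gcongr
      rw [← ENNReal.ofReal_ofNat 8]
      refine ENNReal.ofReal_le_ofReal ?_
      rw [inv_mul_le_iff₀ hs]
      linarith
    _ = _ := by rw [hC₀]; ring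

/-- The density quotients at comparable scales are comparable. -/
theorem exists_capacity_div_le (n : ℕ) (hn : 0 < n) {q : ℝ} (hq : 1 ≤ q) : ∃ C : NNReal,
    ∀ (E : Set (EuclideanSpace ℝ (Fin n))) (x : EuclideanSpace ℝ (Fin n)) (s t : ℝ),
      0 < s → s ≤ t → t ≤ 2 * s →
      capacity q (E ∩ Metric.ball x s) (annulus x (2 * s) (3 * s)) (Metric.ball x (4 * s)) /
        capacity q (Metric.ball x s) (annulus x (2 * s) (3 * s)) (Metric.ball x (4 * s)) ≤ C *
      (capacity q (E ∩ Metric.ball x t) (annulus x (2 * t) (3 * t)) (Metric.ball x (4 * t)) /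
        capacity q (Metric.ball x t) (annulus x (2 * t) (3 * t)) (Metric.ball x (4 * t))) := by
  have hq0 : 0 < q := by linarith
  obtain ⟨A, hA⟩ := exists_capacity_ball_le n hq0
  obtain ⟨B, hB⟩ := exists_le_capacity_ball n hn hq
  obtain ⟨C, hC⟩ := exists_capacity_inter_ball_le n hn hq
  refine ⟨C * (2 ^ n * (A * B)), fun E x s t hs hst hts => ?_⟩
  have ht : 0 < t := by linarith
  have hDt := hA x t ht
  have hDs := hB x s hs
  have hN := hC E x s t hs hst hts
  set Ds := capacity q (Metric.ball x s) (annulus x (2 * s) (3 * s)) (Metric.ball x (4 * s))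
  set Dt := capacity q (Metric.ball x t) (annulus x (2 * t) (3 * t)) (Metric.ball x (4 * t))
  -- Both denominators are comparable to (radius)^(n-q). The factor t^(-q) is bounded by s^(-q), so
  -- only t^n costs a power of 2.
  have hDts : Dt ≤ 2 ^ n * (A * B) * Ds := by
    calc Dt ≤ (ENNReal.ofReal t ^ n * (ENNReal.ofReal t ^ q)⁻¹) * A := hDt
      _ ≤ ((2 * ENNReal.ofReal s) ^ n * (ENNReal.ofReal s ^ q)⁻¹) * A := by
        gcongr
        rw [← ENNReal.ofReal_ofNat 2, ← ENNReal.ofReal_mul (by norm_num)]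
        exact ENNReal.ofReal_le_ofReal hts
      _ = 2 ^ n * A * (ENNReal.ofReal s ^ n * (ENNReal.ofReal s ^ q)⁻¹) := by ring
      _ ≤ 2 ^ n * A * (B * Ds) := by gcongr
      _ = _ := by ring
  have hD0 : ∀ r, 0 < r → capacity q (Metric.ball x r) (annulus x (2 * r) (3 * r))
      (Metric.ball x (4 * r)) ≠ 0 := by
    intro r hr h
    have h1 := hB x r hr
    rw [h, mul_zero, nonpos_iff_eq_zero] at h1
    refine (mul_ne_zero (pow_ne_zero n ?_) (ENNReal.inv_ne_zero.2 (ofReal_rpow_ne_top hr q))) h1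
    simpa using hr
  have hDt0 : Dt ≠ 0 := hD0 t ht
  have hDt' : Dt ≠ ⊤ := by
    refine ne_top_of_le_ne_top ?_ hDt
    refine ENNReal.mul_ne_top (ENNReal.mul_ne_top ?_ ?_) ENNReal.coe_ne_top
    · exact ENNReal.pow_ne_top ENNReal.ofReal_ne_top
    · exact ENNReal.inv_ne_top.2 (ofReal_rpow_ne_zero ht q)
  have hinv : Ds⁻¹ ≤ 2 ^ n * (A * B) * Dt⁻¹ := by
    rw [← div_eq_mul_inv, ENNReal.le_div_iff_mul_le (Or.inl hDt0) (Or.inl hDt'), mul_comm,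
      ← div_eq_mul_inv]
    exact ENNReal.div_le_of_le_mul hDts
  push_cast
  rw [div_eq_mul_inv, div_eq_mul_inv]
  calc _ ≤ _ := mul_le_mul' hN hinv
    _ = _ := by ring

/-! ### Capacitory density implies fatness -/

theorem tendsto_div_four : Tendsto (fun r : ℝ => r / 4) (𝓝[>] 0) (𝓝[>] 0) := by
  refine tendsto_nhdsWithin_iff.2 ⟨?_, ?_⟩
  · refine Tendsto.mono_left ?_ nhdsWithin_le_nhds
    have : Continuous fun r : ℝ => r / 4 := by fun_prop
    simpa using this.tendsto 0
  · filter_upwards [self_mem_nhdsWithin] with r hr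
    exact div_pos (mem_Ioi.1 hr) (by norm_num : (0 : ℝ) < 4)

/-- The substitution t = r/4 turns the radii r/4, r/2, 3r/4, r into t, 2t, 3t, 4t, so the
normalising capacity becomes the one used for thinness. -/
theorem IsCapacitoryDense.exists_frequently {q : ℝ} {E : Set 𝔼} {x : 𝔼}
    (h : IsCapacitoryDense q E x) : ∃ δ : ℝ≥0∞, 0 < δ ∧ ∃ᶠ t in 𝓝[>] (0 : ℝ), δ <
      capacity q (E ∩ Metric.ball x t) (E ∩ annulus x (2 * t) (3 * t)) (Metric.ball x (4 * t)) /
        capacity q (Metric.ball x t) (annulus x (2 * t) (3 * t)) (Metric.ball x (4 * t)) := by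
  obtain ⟨δ, hδ0, hδ⟩ := exists_between h
  refine ⟨δ, hδ0, ?_⟩
  have h1 := frequently_lt_of_lt_limsup (by isBoundedDefault) hδ
  refine tendsto_div_four.frequently (h1.mono fun r hr => ?_)
  have e1 : 2 * (r / 4) = r / 2 := by ring
  have e2 : 3 * (r / 4) = 3 * r / 4 := by ring
  have e3 : 4 * (r / 4) = r := by ring
  rwa [e1, e2, e3]

/-- Shrinking the zero set relaxes both the sign constraint and the continuity requirement, so there
are more competitors. -/
theorem capacity_inter_le (q : ℝ) (E F F' Ω : Set 𝔼) :
    capacity q E (F' ∩ F) Ω ≤ capacity q E F Ω := by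
  refine iInf_le_iInf_of_subset ?_
  rintro u ⟨hu1, hu2, hu3, hu4⟩
  exact ⟨hu1, hu2.mono (union_subset_union_right _ inter_subset_right), hu3,
    fun y hy => hu4 y hy.2⟩

theorem isFat_of_isCapacitoryDense (hn : 0 < n) {q : ℝ} (hq : 1 ≤ q) {E : Set 𝔼} {x : 𝔼}
    (h : IsCapacitoryDense q E x) : IsFat q E x := by
  intro hthin
  obtain ⟨δ, hδ0, hδ'⟩ := h.exists_frequently
  have hδ := hδ'.mono fun t ht =>
    ht.trans_le (ENNReal.div_le_div_right (capacity_inter_le q _ _ E _) _)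
  rcases hq.eq_or_lt with rfl | hq1
  · rw [IsThin, if_pos rfl] at hthin
    obtain ⟨B, hB⟩ := exists_le_capacity_ball n hn (le_refl (1 : ℝ))
    set c := volume (Metric.ball (0 : 𝔼) 1) with hc
    have hc0 : c ≠ 0 := (Metric.measure_ball_pos _ _ one_pos).ne'
    have hct : c ≠ ⊤ := measure_ball_lt_top.ne
    have hk : (B : ℝ≥0∞) * c ≠ ⊤ := ENNReal.mul_ne_top ENNReal.coe_ne_top hct
    have h2 := ENNReal.Tendsto.const_mul (a := (B : ℝ≥0∞) * c) hthin (Or.inr hk)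
    rw [mul_zero] at h2
    refine hδ ?_
    filter_upwards [h2.eventually_lt_const hδ0, self_mem_nhdsWithin] with t ht ht0
    refine not_lt.2 (le_trans ?_ ht.le)
    have ht' : ENNReal.ofReal t ≠ 0 := by simpa using ht0
    have hB' := hB x t ht0
    rw [ENNReal.rpow_one] at hB'
    refine ENNReal.div_le_of_le_mul ?_
    rw [Measure.addHaar_ball_of_pos _ _ ht0, finrank_euclideanSpace_fin, ← hc,
      ENNReal.ofReal_pow (le_of_lt ht0)]
    set N := capacity 1 (E ∩ Metric.ball x t) (annulus x (2 * t) (3 * t)) (Metric.ball x (4 * t))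
    set D := capacity 1 (Metric.ball x t) (annulus x (2 * t) (3 * t)) (Metric.ball x (4 * t))
    set T := ENNReal.ofReal t
    have hTt : T ≠ ⊤ := ENNReal.ofReal_ne_top
    calc N = (T ^ n * T⁻¹) * (c * (T * N / (T ^ n * c))) := by
          have hTn : T ^ n ≠ 0 := pow_ne_zero n ht'
          have hTn' : T ^ n ≠ ⊤ := ENNReal.pow_ne_top hTt
          rw [div_eq_mul_inv, ENNReal.mul_inv (Or.inl hTn) (Or.inl hTn')]
          calc N = (T ^ n * (T ^ n)⁻¹) * (T * T⁻¹) * (c * c⁻¹) * N := by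
                rw [ENNReal.mul_inv_cancel hTn hTn', ENNReal.mul_inv_cancel ht' hTt,
                  ENNReal.mul_inv_cancel hc0 hct]
                simp
            _ = _ := by ring
      _ ≤ (B * D) * (c * (T * N / (T ^ n * c))) := by gcongr
      _ = _ := by ring
  · rw [IsThin, if_neg hq1.ne'] at hthin
    obtain ⟨C, hC⟩ := exists_capacity_div_le n hn hq
    have hp : 0 < 1 / (q - 1) := one_div_pos.2 (by linarith)
    set κ : ℝ≥0∞ := (δ / C) ^ (1 / (q - 1)) with hκ
    have hκ0 : κ ≠ 0 := by
      have : δ / C ≠ 0 := ENNReal.div_ne_zero.2 ⟨hδ0.ne', ENNReal.coe_ne_top⟩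
      rw [hκ, Ne, ENNReal.rpow_eq_zero_iff_of_pos hp]
      exact this
    -- By absolute continuity of a finite integral, its part over (s, 2s) tends to 0 with s. At good
    -- scales that part is at least κ/2: the integrand is at least κ/(2s) on an interval of length
    -- s.
    have hvol : Tendsto ((volume.restrict (Ioo (0 : ℝ) 1)) ∘ fun s => Ioo s (2 * s)) (𝓝[>] 0)
        (𝓝 0) := by
      refine tendsto_of_tendsto_of_tendsto_of_le_of_le (h := fun s => ENNReal.ofReal s)
        tendsto_const_nhds ?_ (fun _ => bot_le) fun s => ?_
      · have := (ENNReal.continuous_ofReal.tendsto 0).mono_left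
          (nhdsWithin_le_nhds (s := Ioi (0 : ℝ)))
        simpa using this
      · refine (Measure.restrict_apply_le _ _).trans (le_of_eq ?_)
        rw [Real.volume_Ioo]
        congr 1
        ring
    have htail := tendsto_setLIntegral_zero hthin.ne hvol
    refine hδ ?_
    filter_upwards [htail.eventually_lt_const (show (0 : ℝ≥0∞) < κ / 2 from
      ENNReal.half_pos hκ0), self_mem_nhdsWithin, Ioo_mem_nhdsGT (show (0 : ℝ) < 1 / 2 by norm_num)]
      with s hs hs0 hs1 hδs
    refine absurd hs (not_lt.2 ?_)
    rw [Measure.restrict_restrict measurableSet_Ioo]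
    have hsub : Ioo s (2 * s) ∩ Ioo 0 1 = Ioo s (2 * s) := by
      refine inter_eq_left.2 (Ioo_subset_Ioo (le_of_lt hs0) ?_)
      linarith [hs1.2]
    rw [hsub]
    have hs0' : 0 < s := hs0
    calc κ / 2 = ∫⁻ _ in Ioo s (2 * s), κ / ENNReal.ofReal (2 * s) := by
          rw [setLIntegral_const, Real.volume_Ioo, show 2 * s - s = s by ring,
            ENNReal.ofReal_mul (by norm_num), div_eq_mul_inv, div_eq_mul_inv,
            ENNReal.mul_inv (by simp) (by simp), mul_assoc, mul_assoc,
            ENNReal.inv_mul_cancel (by simpa using hs0') ENNReal.ofReal_ne_top]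
          simp
      _ ≤ _ := by
          refine setLIntegral_mono' measurableSet_Ioo fun t ht => ?_
          refine ENNReal.div_le_div (ENNReal.rpow_le_rpow ?_ hp.le)
            (ENNReal.ofReal_le_ofReal ht.2.le)
          refine ENNReal.div_le_of_le_mul ?_
          rw [mul_comm]
          exact hδs.le.trans (hC E x s t hs0' ht.1.le ht.2.le)

/-! ### Zero capacity of the axis -/

/-- If at most one term of a sum is nonzero, powers commute with the sum. -/
theorem sum_rpow_of_pairwise {ι : Type*} (s : Finset ι) (f : ι → ℝ≥0∞) {q : ℝ} (hq : 0 < q)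
    (h : ∀ i ∈ s, ∀ j ∈ s, i ≠ j → f i = 0 ∨ f j = 0) :
    (∑ i ∈ s, f i) ^ q = ∑ i ∈ s, f i ^ q := by
  by_cases h0 : ∀ i ∈ s, f i = 0
  · rw [Finset.sum_eq_zero h0, Finset.sum_eq_zero fun i hi => by
      rw [h0 i hi, ENNReal.zero_rpow_of_pos hq], ENNReal.zero_rpow_of_pos hq]
  · push Not at h0
    obtain ⟨i, hi, hfi⟩ := h0
    have h1 : ∀ j ∈ s, j ≠ i → f j = 0 := fun j hj hji => (h j hj i hi hji).resolve_right hfi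
    rw [Finset.sum_eq_single_of_mem i hi h1, Finset.sum_eq_single_of_mem i hi fun j hj hji => by
      rw [h1 j hj hji, ENNReal.zero_rpow_of_pos hq]]

/-- The projection onto the hyperplane orthogonal to the axis of the cusp. -/
noncomputable def axisProj (n : ℕ) [NeZero n] :
    EuclideanSpace ℝ (Fin n) →L[ℝ] EuclideanSpace ℝ (Fin n) :=
  ContinuousLinearMap.id ℝ _ -
    (EuclideanSpace.proj (0 : Fin n) : EuclideanSpace ℝ (Fin n) →L[ℝ] ℝ).smulRight
      (EuclideanSpace.single 0 1)

variable [NeZero n]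

theorem axisProj_apply (z : 𝔼) : axisProj n z = z - EuclideanSpace.single 0 (z 0) := by
  ext i
  simp [axisProj]

theorem axisProj_coord (z : 𝔼) (i : Fin n) : axisProj n z i = if i = 0 then 0 else z i := by
  rw [axisProj_apply]
  by_cases h : i = 0
  · subst h; simp
  · simp [h]

theorem norm_axisProj_le (z : 𝔼) : ‖axisProj n z‖ ≤ ‖z‖ := by
  rw [EuclideanSpace.norm_eq, EuclideanSpace.norm_eq]
  refine Real.sqrt_le_sqrt (Finset.sum_le_sum fun i _ => ?_)
  rw [axisProj_coord]
  split_ifs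
  · simpa using sq_nonneg (z i)
  · rfl

theorem enorm_axisProj_le : ‖axisProj n‖ₑ ≤ 1 := by
  rw [← ofReal_norm]
  refine ENNReal.ofReal_le_one.2 (ContinuousLinearMap.opNorm_le_bound _ zero_le_one fun z => ?_)
  rw [one_mul]
  exact norm_axisProj_le z

/-- The volume of a truncated cylinder around the axis. -/
theorem volume_cylinder_le (ρ : ℝ) : volume {z : 𝔼 | ‖z‖ ≤ 2 ∧ ‖axisProj n z‖ ≤ ρ} ≤
    4 * ENNReal.ofReal (2 * ρ) ^ (n - 1) := by
  set a : Fin n → ℝ := fun i => if i = 0 then 2 else ρ with ha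
  have hpre : {z : 𝔼 | ‖z‖ ≤ 2 ∧ ‖axisProj n z‖ ≤ ρ} ⊆
      (MeasurableEquiv.toLp 2 (Fin n → ℝ)).symm ⁻¹' Icc (-a) a := by
    rintro z ⟨h1, h2⟩
    have h3 : ∀ i, |z i| ≤ a i := by
      intro i
      by_cases h : i = 0
      · rw [ha]
        simp only [h, if_true]
        exact (PiLp.norm_apply_le z 0).trans h1
      · have h4 := (PiLp.norm_apply_le (axisProj n z) i).trans h2
        rw [axisProj_coord, if_neg h] at h4
        simpa [ha, h] using h4
    exact ⟨fun i => (abs_le.1 (h3 i)).1, fun i => (abs_le.1 (h3 i)).2⟩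
  refine (measure_mono hpre).trans (le_of_eq ?_)
  rw [(EuclideanSpace.volume_preserving_symm_measurableEquiv_toLp (Fin n)).measure_preimage
    measurableSet_Icc.nullMeasurableSet, Real.volume_Icc_pi,
    ← Finset.mul_prod_erase _ _ (Finset.mem_univ (0 : Fin n))]
  rw [Finset.prod_congr rfl (g := fun _ => ENNReal.ofReal (2 * ρ))]
  · rw [Finset.prod_const, Finset.card_erase_of_mem (Finset.mem_univ _), Finset.card_univ,
      Fintype.card_fin]
    congr 1
    simp only [ha, Pi.neg_apply, if_true]
    norm_num
  · intro i hi
    simp only [ha, Pi.neg_apply, if_neg (Finset.ne_of_mem_erase hi)]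
    congr 1; ring

/-- A dyadic shell around the axis. -/
def axisShell (n : ℕ) [NeZero n] (j : ℕ) : Set (EuclideanSpace ℝ (Fin n)) :=
  {z | ‖z‖ ≤ 2 ∧ 1 ≤ 2 ^ j * ‖axisProj n z‖ ∧ 2 ^ j * ‖axisProj n z‖ < 2}

theorem measurableSet_axisShell (j : ℕ) : MeasurableSet (axisShell n j) := by
  have hc : Continuous fun z : 𝔼 => 2 ^ j * ‖axisProj n z‖ := by fun_prop
  exact (measurableSet_le continuous_norm.measurable measurable_const).inter
    ((measurableSet_le measurable_const hc.measurable).inter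
      (measurableSet_lt hc.measurable measurable_const))

/-- Disjointness lets the q-th power pass through the sum of dyadic derivatives in the energy
estimate. -/
theorem axisShell_disjoint {i j : ℕ} (hij : i ≠ j) {z : 𝔼} (hi : z ∈ axisShell n i) :
    z ∉ axisShell n j := by
  intro hj
  have key : ∀ {i j : ℕ}, i < j → z ∈ axisShell n i → z ∈ axisShell n j → False := by
    intro i j h hi hj
    have h1 : (2 : ℝ) ^ (i + 1) ≤ 2 ^ j := pow_le_pow_right₀ one_le_two h
    have h2 := mul_le_mul_of_nonneg_right h1 (norm_nonneg (axisProj n z))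
    rw [pow_succ] at h2
    have := hi.2.1
    have := hj.2.2
    linarith
  rcases lt_or_gt_of_ne hij with h | h
  · exact key h hi hj
  · exact key h hj hi

/-- The shell lies in a cylinder of radius 2·2^(-j) with n - 1 transverse directions, so its volume
is O(2^(-j(n-1))). The condition q ≤ n - 1 is exactly what keeps the weighted volume bounded in j.
-/
theorem volume_axisShell_le {q : ℝ} (hqn : q ≤ (n : ℝ) - 1) (j : ℕ) :
    (2 ^ j : ℝ≥0∞) ^ q * volume (axisShell n j) ≤ 4 * 4 ^ (n - 1) := by
  have hsub : axisShell n j ⊆ {z : 𝔼 | ‖z‖ ≤ 2 ∧ ‖axisProj n z‖ ≤ 2 * (2 ^ j)⁻¹} := by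
    rintro z ⟨h1, -, h3⟩
    refine ⟨h1, ?_⟩
    rw [← div_eq_mul_inv, le_div_iff₀ (by positivity), mul_comm]
    exact h3.le
  have hn1 : 1 ≤ n := NeZero.one_le
  have h2j : (1 : ℝ≥0∞) ≤ 2 ^ j := one_le_pow₀ (by norm_num)
  have hpow : ((2 : ℝ≥0∞) ^ j) ^ q ≤ (2 ^ j) ^ (n - 1) := by
    rw [← ENNReal.rpow_natCast (2 ^ j) (n - 1)]
    refine ENNReal.rpow_le_rpow_of_exponent_le h2j ?_
    push_cast [hn1]
    exact hqn
  have hof : ENNReal.ofReal (2 * (2 * (2 ^ j)⁻¹)) = 4 * (2 ^ j)⁻¹ := by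
    rw [← mul_assoc, ENNReal.ofReal_mul (by norm_num), ENNReal.ofReal_inv_of_pos (by positivity),
      ENNReal.ofReal_pow (by norm_num)]
    norm_num
  calc _ ≤ ((2 : ℝ≥0∞) ^ j) ^ (n - 1) * (4 * (4 * (2 ^ j)⁻¹) ^ (n - 1)) := by
        refine mul_le_mul' hpow ((measure_mono hsub).trans ((volume_cylinder_le _).trans ?_))
        rw [hof]
    _ = 4 * ((2 ^ j * (2 ^ j)⁻¹) * 4) ^ (n - 1) := by
        rw [mul_pow, mul_pow, mul_pow]; ring
    _ = _ := by
        rw [ENNReal.mul_inv_cancel (by positivity) (ENNReal.pow_ne_top ENNReal.ofNat_ne_top),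
          one_mul]

/-- A smooth cutoff function whose derivative lives in the shell `1 ≤ ‖y‖ ≤ 3/2`. -/
theorem exists_shell_cutoff (n : ℕ) : ∃ b : EuclideanSpace ℝ (Fin n) → ℝ, ContDiff ℝ ∞ b ∧
    (∀ y, ‖y‖ ≤ 1 → b y = 1) ∧ (∀ y, 3 / 2 ≤ ‖y‖ → b y = 0) ∧ (∀ y, 0 ≤ b y) ∧ (∀ y, b y ≤ 1) ∧
    (∀ y, ‖y‖ < 1 → fderiv ℝ b y = 0) ∧ (∀ y, 3 / 2 < ‖y‖ → fderiv ℝ b y = 0) ∧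
      ∃ K : NNReal, ∀ y, ‖fderiv ℝ b y‖ₑ ≤ K := by
  let b : ContDiffBump (0 : EuclideanSpace ℝ (Fin n)) := ⟨1, 3 / 2, one_pos, by norm_num⟩
  have hb : ContDiff ℝ ∞ b := b.contDiff
  have h1 : ∀ y, ‖y‖ ≤ 1 → b y = 1 := fun y hy => b.one_of_mem_closedBall (by simpa using hy)
  have h0 : ∀ y, 3 / 2 ≤ ‖y‖ → b y = 0 := fun y hy => b.zero_of_le_dist (by simpa using hy)
  refine ⟨b, hb, h1, h0, fun y => b.nonneg, fun y => b.le_one, fun y hy => ?_, fun y hy => ?_, ?_⟩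
  · have : b =ᶠ[𝓝 y] fun _ => 1 := by
      filter_upwards [(isOpen_lt continuous_norm continuous_const).mem_nhds hy] with z hz
      exact h1 z (le_of_lt hz)
    rw [this.fderiv_eq, fderiv_fun_const, Pi.zero_apply]
  · have : b =ᶠ[𝓝 y] fun _ => 0 := by
      filter_upwards [(isOpen_lt continuous_const continuous_norm).mem_nhds hy] with z hz
      exact h0 z (le_of_lt hz)
    rw [this.fderiv_eq, fderiv_fun_const, Pi.zero_apply]
  · obtain ⟨K, hK⟩ := (hb.continuous_fderiv (by simp)).bounded_above_of_compact_support
      (b.hasCompactSupport.fderiv ℝ)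
    refine ⟨K.toNNReal, fun y => ?_⟩
    rw [← ofReal_norm]
    exact ENNReal.ofReal_le_ofReal (hK y)

theorem enorm_fderiv_comp_axisProj_le {b : 𝔼 → ℝ} (hb : ContDiff ℝ ∞ b)
    (h1 : ∀ y, ‖y‖ < 1 → fderiv ℝ b y = 0) (h0 : ∀ y, 3 / 2 < ‖y‖ → fderiv ℝ b y = 0)
    {K : NNReal} (hK : ∀ y, ‖fderiv ℝ b y‖ₑ ≤ K) (j : ℕ) {z : 𝔼} (hz : ‖z‖ ≤ 2) :
    ‖fderiv ℝ (fun z => b ((2 : ℝ) ^ j • axisProj n z)) z‖ₑ ≤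
      (axisShell n j).indicator (fun _ => (K : ℝ≥0∞) * 2 ^ j) z := by
  have hd : fderiv ℝ (fun z => b ((2 : ℝ) ^ j • axisProj n z)) z =
      (2 : ℝ) ^ j • (fderiv ℝ b ((2 : ℝ) ^ j • axisProj n z)).comp (axisProj n) := by
    have h2 := (hb.differentiable (by simp) ((2 : ℝ) ^ j • axisProj n z)).hasFDerivAt.comp z
      ((axisProj n).hasFDerivAt.const_smul ((2 : ℝ) ^ j))
    refine h2.fderiv.trans ?_
    ext; simp
  have hnorm : ‖(2 : ℝ) ^ j • axisProj n z‖ = 2 ^ j * ‖axisProj n z‖ := by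
    rw [norm_smul, Real.norm_of_nonneg (by positivity)]
  rw [hd]
  by_cases hs : z ∈ axisShell n j
  · rw [indicator_of_mem hs, enorm_smul, mul_comm]
    refine mul_le_mul' ?_ (le_of_eq ?_)
    · refine (ContinuousLinearMap.opENorm_comp_le _ _).trans ?_
      refine (mul_le_mul' (hK _) enorm_axisProj_le).trans (le_of_eq (mul_one _))
    · rw [Real.enorm_of_nonneg (by positivity), ENNReal.ofReal_pow (by norm_num)]
      norm_num
  · have : fderiv ℝ b ((2 : ℝ) ^ j • axisProj n z) = 0 := by
      by_cases h : 1 ≤ 2 ^ j * ‖axisProj n z‖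
      · refine h0 _ ?_
        rw [hnorm]
        by_contra h3
        exact hs ⟨hz, h, by linarith⟩
      · exact h1 _ (by rw [hnorm]; exact not_le.1 h)
    rw [this, ContinuousLinearMap.zero_comp, smul_zero, ← ofReal_norm, norm_zero,
      ENNReal.ofReal_zero]
    exact bot_le

/-- Averaged dyadic cutoffs around the axis. -/
theorem exists_axis_testFunction (n : ℕ) [NeZero n] {q : ℝ} (hq : 1 < q)
    (hqn : q ≤ (n : ℝ) - 1) : ∃ C : NNReal, ∀ N : ℕ, 0 < N → ∃ κ : ℝ, 0 < κ ∧
      ∃ F : EuclideanSpace ℝ (Fin n) → ℝ,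
        IsTestFunction {z | ‖z‖ ≤ 1 ∧ ‖axisProj n z‖ ≤ κ} 0 1 F ∧
        ∫⁻ y, ‖fderiv ℝ F y‖ₑ ^ q ≤ C * ENNReal.ofReal ((1 / 2) ^ N + (N : ℝ) ^ (1 - q)) := by
  obtain ⟨b, hb, hb1, hb0, hbn, hble, hdb1, hdb0, K, hK⟩ := exists_shell_cutoff n
  have hq0 : 0 < q := by linarith
  -- The dyadic indices run from N + 1 to 2N. The finest cutoff equals 1 for |Pz| ≤ 2^(-2N), P being
  -- the projection off the axis, which dictates κ.
  refine ⟨2 ^ (q - 1) * (K ^ q * (4 * 4 ^ (n - 1))),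
    fun N hN => ⟨(2 ^ (2 * N))⁻¹, by positivity, ?_⟩⟩
  have hN0 : (N : ℝ) ≠ 0 := by positivity
  have hn2 : 1 ≤ n - 1 := by
    have : (1 : ℝ) < n - 1 := by linarith
    have : (2 : ℝ) < n := by linarith
    have : 2 < n := by exact_mod_cast this
    omega
  set g : ℕ → EuclideanSpace ℝ (Fin n) → ℝ :=
    fun k z => b ((2 : ℝ) ^ (N + 1 + k) • axisProj n z) with hg
  have hgc : ∀ k, ContDiff ℝ ∞ (g k) := fun k => hb.comp (by fun_prop)
  set h : EuclideanSpace ℝ (Fin n) → ℝ := fun z => (N : ℝ)⁻¹ * ∑ k ∈ Finset.range N, g k z with hh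
  have hhc : ContDiff ℝ ∞ h := contDiff_const.mul (ContDiff.sum fun k _ => hgc k)
  have hnorm : ∀ (j : ℕ) (z : EuclideanSpace ℝ (Fin n)),
      ‖(2 : ℝ) ^ j • axisProj n z‖ = 2 ^ j * ‖axisProj n z‖ := fun j z => by
    rw [norm_smul, Real.norm_of_nonneg (by positivity)]
  refine ⟨fun z => b z * h z, ⟨hb.mul hhc, ?_, fun y hy => ?_⟩, ?_⟩
  · rintro z ⟨hz1, hz2⟩
    have : ∀ k ∈ Finset.range N, g k z = 1 := by
      intro k hk
      refine hb1 _ ?_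
      rw [hnorm]
      calc (2 : ℝ) ^ (N + 1 + k) * ‖axisProj n z‖ ≤ 2 ^ (2 * N) * (2 ^ (2 * N))⁻¹ := by
            gcongr
            · norm_num
            · have := Finset.mem_range.1 hk
              omega
        _ = 1 := mul_inv_cancel₀ (by positivity)
    simp only [hh, Finset.sum_congr rfl this, hb1 z hz1]
    simp [hN0]
  · rw [hb0 y (by simp at hy; linarith), zero_mul]
  set U : Set (EuclideanSpace ℝ (Fin n)) :=
    {z | ‖z‖ ≤ 2 ∧ ‖axisProj n z‖ ≤ (2 ^ N)⁻¹} with hU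
  have hUm : MeasurableSet U := by
    have hc : Continuous fun z : EuclideanSpace ℝ (Fin n) => ‖axisProj n z‖ := by fun_prop
    exact (measurableSet_le continuous_norm.measurable measurable_const).inter
      (measurableSet_le hc.measurable measurable_const)
  have hh1 : ∀ z, ‖h z‖ₑ ≤ 1 := by
    intro z
    have h2 : ∑ k ∈ Finset.range N, g k z ≤ N := by
      refine (Finset.sum_le_sum fun k _ => hble _).trans ?_
      simp
    have h3 : 0 ≤ ∑ k ∈ Finset.range N, g k z := Finset.sum_nonneg fun k _ => hbn _
    rw [Real.enorm_of_nonneg (by positivity)]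
    refine ENNReal.ofReal_le_one.2 ?_
    rw [hh]
    exact (inv_mul_le_one₀ (by positivity)).2 h2
  -- Even the coarsest cutoff vanishes outside the cylinder of radius 2^(-N). Hence the derivative
  -- of the outer cutoff b only costs the volume of U, which is O(2^(-N)) because n - 1 ≥ 1.
  have hh0 : ∀ z, (2 ^ N)⁻¹ < ‖axisProj n z‖ → h z = 0 := by
    intro z hz
    have : ∀ k ∈ Finset.range N, g k z = 0 := by
      intro k _
      refine hb0 _ ?_
      rw [hnorm]
      have h4 : (2 : ℝ) ^ (N + 1) * (2 ^ N)⁻¹ = 2 := by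
        rw [pow_succ]; field_simp
      have h5 : (2 : ℝ) ^ (N + 1) ≤ 2 ^ (N + 1 + k) :=
        pow_le_pow_right₀ one_le_two (by omega)
      have h6 : (2 : ℝ) ^ (N + 1) * (2 ^ N)⁻¹ ≤ 2 ^ (N + 1 + k) * ‖axisProj n z‖ := by gcongr
      linarith
    simp only [hh, Finset.sum_eq_zero this, mul_zero]
  have hdh : ∀ z, ‖z‖ ≤ 2 → ‖fderiv ℝ h z‖ₑ ≤ (N : ℝ≥0∞)⁻¹ * ∑ k ∈ Finset.range N,
      (axisShell n (N + 1 + k)).indicator (fun _ => (K : ℝ≥0∞) * 2 ^ (N + 1 + k)) z := by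
    intro z hz
    have h7 : fderiv ℝ h z = (N : ℝ)⁻¹ • ∑ k ∈ Finset.range N, fderiv ℝ (g k) z := by
      rw [hh, fderiv_const_mul, fderiv_fun_sum]
      · exact fun k _ => (hgc k).differentiable (by simp) z
      · exact DifferentiableAt.fun_sum fun k _ => (hgc k).differentiable (by simp) z
    rw [h7, enorm_smul]
    refine mul_le_mul' (le_of_eq ?_) ?_
    · rw [Real.enorm_of_nonneg (by positivity), ENNReal.ofReal_inv_of_pos (by positivity),
        ENNReal.ofReal_natCast]
    · have hsum : ∀ (s : Finset ℕ) (f : ℕ → EuclideanSpace ℝ (Fin n) →L[ℝ] ℝ),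
          ‖∑ k ∈ s, f k‖ₑ ≤ ∑ k ∈ s, ‖f k‖ₑ := fun s f => enorm_sum_le s f
      refine (hsum _ _).trans (Finset.sum_le_sum fun k _ => ?_)
      exact enorm_fderiv_comp_axisProj_le hb hdb1 hdb0 hK _ hz
  have hpt : ∀ z, ‖fderiv ℝ (fun z => b z * h z) z‖ₑ ≤ U.indicator (fun _ => (K : ℝ≥0∞)) z +
      (N : ℝ≥0∞)⁻¹ * ∑ k ∈ Finset.range N,
      (axisShell n (N + 1 + k)).indicator (fun _ => (K : ℝ≥0∞) * 2 ^ (N + 1 + k)) z := by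
    intro z
    rw [fderiv_fun_mul (hb.differentiable (by simp) z) (hhc.differentiable (by simp) z), add_comm]
    by_cases hz : ‖z‖ ≤ 2
    · refine (enorm_clm_add_le _ _).trans (add_le_add ?_ ?_)
      · rw [enorm_smul]
        by_cases hzU : z ∈ U
        · rw [indicator_of_mem hzU]
          exact (mul_le_mul' (hh1 z) (hK z)).trans (le_of_eq (one_mul _))
        · rw [hh0 z (not_le.1 fun h8 => hzU ⟨hz, h8⟩)]
          simp
      · rw [enorm_smul]
        refine (mul_le_of_le_one_left' ?_).trans (hdh z hz)
        rw [Real.enorm_of_nonneg (hbn z)]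
        exact ENNReal.ofReal_le_one.2 (hble z)
    · push Not at hz
      rw [hb0 z (by linarith), hdb0 z (by linarith), zero_smul, smul_zero, add_zero, ← ofReal_norm,
        norm_zero, ENNReal.ofReal_zero]
      exact bot_le
  have h2t : (2 : ℝ≥0∞) ^ (q - 1) ≠ ⊤ :=
    ENNReal.rpow_ne_top_of_nonneg (by linarith) ENNReal.ofNat_ne_top
  have hpt' : ∀ z, ‖fderiv ℝ (fun z => b z * h z) z‖ₑ ^ q ≤ 2 ^ (q - 1) *
      (U.indicator (fun _ => (K : ℝ≥0∞) ^ q) z + ((N : ℝ≥0∞)⁻¹) ^ q * ∑ k ∈ Finset.range N,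
      (axisShell n (N + 1 + k)).indicator
        (fun _ => (K : ℝ≥0∞) ^ q * (2 ^ (N + 1 + k)) ^ q) z) := by
    intro z
    refine (ENNReal.rpow_le_rpow (hpt z) hq0.le).trans
      ((ENNReal.rpow_add_le_mul_rpow_add_rpow _ _ hq.le).trans (le_of_eq ?_))
    congr 2
    · by_cases hzU : z ∈ U <;>
        simp only [indicator_of_mem, indicator_of_notMem, hzU, not_false_eq_true,
          ENNReal.zero_rpow_of_pos hq0]
    · rw [ENNReal.mul_rpow_of_nonneg _ _ hq0.le, sum_rpow_of_pairwise _ _ hq0]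
      · congr 1
        refine Finset.sum_congr rfl fun k _ => ?_
        by_cases hzU : z ∈ axisShell n (N + 1 + k) <;>
          simp only [indicator_of_mem, indicator_of_notMem, hzU, not_false_eq_true,
            ENNReal.zero_rpow_of_pos hq0, ENNReal.mul_rpow_of_nonneg _ _ hq0.le]
      · intro i _ j _ hij
        by_cases hzi : z ∈ axisShell n (N + 1 + i)
        · exact Or.inr (indicator_of_notMem (axisShell_disjoint (by omega) hzi) _)
        · exact Or.inl (indicator_of_notMem hzi _)
  have hNq : ((N : ℝ≥0∞)⁻¹) ^ q ≠ ⊤ :=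
    ENNReal.rpow_ne_top_of_nonneg hq0.le (ENNReal.inv_ne_top.2 (by exact_mod_cast hN.ne'))
  have hUvol : volume U ≤ 4 * 4 ^ (n - 1) * ENNReal.ofReal ((1 / 2) ^ N) := by
    refine (volume_cylinder_le _).trans ?_
    rw [mul_assoc]
    gcongr
    rw [ENNReal.ofReal_mul (by norm_num), mul_pow]
    refine mul_le_mul' ?_ ?_
    · gcongr
      norm_num
    · rw [← inv_pow, ← one_div]
      refine pow_le_of_le_one (by positivity) ?_ (by omega)
      exact ENNReal.ofReal_le_one.2 (pow_le_one₀ (by norm_num) (by norm_num))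
  calc _ ≤ _ := lintegral_mono hpt'
    _ = 2 ^ (q - 1) * ((K : ℝ≥0∞) ^ q * volume U + ((N : ℝ≥0∞)⁻¹) ^ q * ∑ k ∈ Finset.range N,
        (K : ℝ≥0∞) ^ q * ((2 ^ (N + 1 + k)) ^ q * volume (axisShell n (N + 1 + k)))) := by
      rw [lintegral_const_mul' _ _ h2t, lintegral_add_left (measurable_const.indicator hUm),
        lintegral_indicator_const hUm, lintegral_const_mul' _ _ hNq, lintegral_finsetSum _
          fun k _ => measurable_const.indicator (measurableSet_axisShell _)]
      simp only [lintegral_indicator_const (measurableSet_axisShell _), mul_assoc]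
    _ ≤ 2 ^ (q - 1) * ((K : ℝ≥0∞) ^ q * (4 * 4 ^ (n - 1) * ENNReal.ofReal ((1 / 2) ^ N)) +
        ((N : ℝ≥0∞)⁻¹) ^ q * ∑ k ∈ Finset.range N, (K : ℝ≥0∞) ^ q * (4 * 4 ^ (n - 1))) := by
      gcongr 2 ^ (q - 1) * (_ * ?_ + _ * ∑ k ∈ Finset.range N, _ * ?_)
      exact volume_axisShell_le hqn _
    _ = _ := by
      -- Averaging N functions with disjointly supported derivatives of bounded energy gives
      -- N^(-q)·N, which tends to 0 precisely because q > 1.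
      have h9 : ((N : ℝ≥0∞)⁻¹) ^ q * N = ENNReal.ofReal ((N : ℝ) ^ (1 - q)) := by
        have hNp : (0 : ℝ) < N := by positivity
        rw [← ENNReal.ofReal_natCast, ← ENNReal.ofReal_inv_of_pos hNp,
          ENNReal.ofReal_rpow_of_pos (inv_pos.2 hNp), ← ENNReal.ofReal_mul (by positivity),
          Real.inv_rpow hNp.le, sub_eq_add_neg, Real.rpow_add hNp, Real.rpow_one,
          Real.rpow_neg hNp.le, mul_comm]
      rw [ENNReal.ofReal_add (by positivity) (by positivity), ← h9, Finset.sum_const,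
        Finset.card_range, nsmul_eq_mul]
      push_cast [ENNReal.coe_rpow_of_nonneg _ hq0.le,
        ENNReal.coe_rpow_of_nonneg _ (sub_nonneg.2 hq.le)]
      ring

/-- Neighbourhoods of the axis have arbitrarily small capacity. -/
theorem exists_small_energy (n : ℕ) [NeZero n] {q : ℝ} (hq : 1 < q) (hqn : q ≤ (n : ℝ) - 1)
    {ε : ℝ≥0∞} (hε : 0 < ε) : ∃ κ : ℝ, 0 < κ ∧ ∃ F : EuclideanSpace ℝ (Fin n) → ℝ,
      IsTestFunction {z | ‖z‖ ≤ 1 ∧ ‖axisProj n z‖ ≤ κ} 0 1 F ∧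
        ∫⁻ y, ‖fderiv ℝ F y‖ₑ ^ q ≤ ε := by
  obtain ⟨C, hC⟩ := exists_axis_testFunction n hq hqn
  have h1 : Tendsto (fun N : ℕ => ((1 / 2 : ℝ)) ^ N + (N : ℝ) ^ (1 - q)) atTop (𝓝 (0 + 0)) := by
    refine (tendsto_pow_atTop_nhds_zero_of_lt_one (by norm_num) (by norm_num)).add ?_
    have := (tendsto_rpow_neg_atTop (y := q - 1) (by linarith)).comp tendsto_natCast_atTop_atTop
    simpa [Function.comp_def] using this
  have h2 := ENNReal.Tendsto.const_mul (a := (C : ℝ≥0∞)) (ENNReal.tendsto_ofReal h1)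
    (Or.inr ENNReal.coe_ne_top)
  rw [add_zero, ENNReal.ofReal_zero, mul_zero] at h2
  obtain ⟨N, hN, hN0⟩ := ((h2.eventually_lt_const hε).and (eventually_gt_atTop 0)).exists
  obtain ⟨κ, hκ, F, hF, hF2⟩ := hC N hN0
  exact ⟨κ, hκ, F, hF, hF2.trans hN.le⟩

/-! ### The logarithmic cusp function -/

/-- The cusp function `t (1 - log t) ^ (-α)`, continued linearly beyond `1`. -/
noncomputable def logCusp (α t : ℝ) : ℝ :=
  if t ≤ 1 then t * (1 - Real.log t) ^ (-α) else 1 + (1 + α) * (t - 1)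

theorem logCusp_of_le {α t : ℝ} (ht : t ≤ 1) : logCusp α t = t * (1 - Real.log t) ^ (-α) :=
  if_pos ht

theorem logCusp_of_one_le {α t : ℝ} (ht : 1 ≤ t) : logCusp α t = 1 + (1 + α) * (t - 1) := by
  rcases ht.eq_or_lt with rfl | h
  · simp [logCusp]
  · exact if_neg (not_le.2 h)

theorem one_le_one_sub_log {t : ℝ} (h0 : 0 < t) (h1 : t ≤ 1) : 1 ≤ 1 - Real.log t := by
  linarith [Real.log_nonpos h0.le h1]

theorem hasDerivAt_mul_log_rpow (α : ℝ) {t : ℝ} (h0 : 0 < t) (h1 : t ≤ 1) :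
    HasDerivAt (fun t => t * (1 - Real.log t) ^ (-α))
      ((1 - Real.log t) ^ (-α) + α * (1 - Real.log t) ^ (-α - 1)) t := by
  have hL := one_le_one_sub_log h0 h1
  have h2 := (((Real.hasDerivAt_log h0.ne').const_sub 1).rpow_const (p := -α)
    (Or.inl (by linarith : 1 - Real.log t ≠ 0)))
  have h3 := (hasDerivAt_id t).mul h2
  refine h3.congr_deriv ?_
  simp only [id]
  field_simp

theorem hasDerivAt_logCusp_of_lt (α : ℝ) {t : ℝ} (h0 : 0 < t) (h1 : t < 1) :
    HasDerivAt (logCusp α) ((1 - Real.log t) ^ (-α) + α * (1 - Real.log t) ^ (-α - 1)) t := by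
  refine (hasDerivAt_mul_log_rpow α h0 h1.le).congr_of_eventuallyEq ?_
  filter_upwards [Iio_mem_nhds h1] with s hs using logCusp_of_le (le_of_lt hs)

/-- The slope 1 + α of the linear continuation is the left derivative at 1 of the logarithmic
branch, so the two pieces join differentiably. -/
theorem hasDerivAt_logCusp_of_one_le (α : ℝ) {t : ℝ} (h1 : 1 ≤ t) :
    HasDerivAt (logCusp α) (1 + α) t := by
  have hlin : HasDerivAt (fun t : ℝ => 1 + (1 + α) * (t - 1)) (1 + α) t := by
    simpa using (((hasDerivAt_id t).sub_const 1).const_mul (1 + α)).const_add 1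
  rcases h1.eq_or_lt with rfl | h
  · have hl : HasDerivWithinAt (logCusp α) (1 + α) (Iic 1) 1 := by
      have := (hasDerivAt_mul_log_rpow α one_pos le_rfl).hasDerivWithinAt (s := Iic 1)
      simp only [Real.log_one, sub_zero, Real.one_rpow, mul_one] at this
      exact this.congr (fun s hs => logCusp_of_le hs) (logCusp_of_le le_rfl)
    have hr : HasDerivWithinAt (logCusp α) (1 + α) (Ici 1) 1 :=
      hlin.hasDerivWithinAt.congr (fun s hs => logCusp_of_one_le hs) (logCusp_of_one_le le_rfl)
    have := hl.union hr
    rwa [Iic_union_Ici, hasDerivWithinAt_univ] at this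
  · refine hlin.congr_of_eventuallyEq ?_
    filter_upwards [Ioi_mem_nhds h] with s hs using logCusp_of_one_le (le_of_lt hs)

theorem tendsto_one_sub_log : Tendsto (fun t => 1 - Real.log t) (𝓝[>] 0) atTop :=
  tendsto_atTop_add_const_left _ 1 (tendsto_neg_atBot_atTop.comp Real.tendsto_log_nhdsGT_zero)

theorem tendsto_one_sub_log_rpow {α : ℝ} (hα : 0 < α) :
    Tendsto (fun t => (1 - Real.log t) ^ (-α)) (𝓝[>] 0) (𝓝 0) :=
  (tendsto_rpow_neg_atTop hα).comp tendsto_one_sub_log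

theorem hasDerivWithinAt_logCusp_zero {α : ℝ} (hα : 0 < α) :
    HasDerivWithinAt (logCusp α) 0 (Ici 0) 0 := by
  rw [hasDerivWithinAt_iff_tendsto_slope]
  have : Ici (0 : ℝ) \ {0} = Ioi 0 := by
    ext; simp [lt_iff_le_and_ne, eq_comm]
  rw [this]
  refine (tendsto_one_sub_log_rpow hα).congr' ?_
  filter_upwards [Ioc_mem_nhdsGT (one_pos : (0 : ℝ) < 1)] with t ht
  have h0 : logCusp α 0 = 0 := by rw [logCusp_of_le zero_le_one, zero_mul]
  rw [slope_def_field, h0, logCusp_of_le ht.2]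
  have := ht.1.ne'
  field_simp
  ring

theorem isCuspFunction_logCusp {α : ℝ} (hα : 0 < α) : IsCuspFunction (logCusp α) := by
  have hdiff : DifferentiableOn ℝ (logCusp α) (Ici 0) := by
    intro t ht
    rcases (mem_Ici.1 ht).eq_or_lt with rfl | h0
    · exact (hasDerivWithinAt_logCusp_zero hα).differentiableWithinAt
    rcases lt_or_ge t 1 with h1 | h1
    · exact (hasDerivAt_logCusp_of_lt α h0 h1).differentiableAt.differentiableWithinAt
    · exact (hasDerivAt_logCusp_of_one_le α h1).differentiableAt.differentiableWithinAt
  have hmono : StrictMonoOn (logCusp α) (Ici 0) := by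
    refine strictMonoOn_of_deriv_pos (convex_Ici 0) hdiff.continuousOn fun t ht => ?_
    rw [interior_Ici, mem_Ioi] at ht
    rcases lt_or_ge t 1 with h1 | h1
    · rw [(hasDerivAt_logCusp_of_lt α ht h1).deriv]
      have := one_le_one_sub_log ht h1.le
      positivity
    · rw [(hasDerivAt_logCusp_of_one_le α h1).deriv]
      positivity
  have hone : logCusp α 1 = 1 := by simp [logCusp]
  refine ⟨hdiff.continuousOn, hmono, hdiff, by simp [logCusp], hone, ?_, ?_, ?_⟩
  · set m := logCusp α (1 / 2) with hm
    have hm0 : 0 < m := by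
      have := one_le_one_sub_log (t := 1 / 2) (by norm_num) (by norm_num)
      rw [hm, logCusp_of_le (by norm_num)]
      positivity
    have hm1 : m ≤ 1 := by
      rw [← hone]
      exact hmono.monotoneOn (by norm_num) (by norm_num) (by norm_num)
    -- The first summand serves t ≤ 1/2, where 1 - log(2t) is at least half of 1 - log t; the second
    -- serves t > 1/2, where the value at t is at least m.
    refine ⟨2 * 2 ^ α + (2 + α) / m, fun t ht => ?_⟩
    have hwt : 0 ≤ logCusp α t := by
      have := hmono.monotoneOn (mem_Ici.2 le_rfl) ht.le ht.le
      rwa [logCusp_of_le zero_le_one, zero_mul] at this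
    have hdm : 2 + α ≤ (2 + α) / m := by
      rw [le_div_iff₀ hm0]
      nlinarith
    have h2α : (0 : ℝ) < 2 ^ α := by positivity
    rw [add_mul]
    rcases le_or_gt t (1 / 2) with h | h
    · refine le_add_of_le_of_nonneg ?_ (by positivity)
      have h1 := one_le_one_sub_log (t := 2 * t) (by linarith) (by linarith)
      have h2 := one_le_one_sub_log ht (by linarith)
      have h3 : Real.log (2 * t) = Real.log 2 + Real.log t := Real.log_mul (by norm_num) ht.ne'
      have h4 : Real.log 2 ≤ 1 := by linarith [Real.log_two_lt_d9]
      rw [logCusp_of_le (by linarith), logCusp_of_le (by linarith)]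
      have h5 : (1 - Real.log (2 * t)) ^ (-α) ≤ 2 ^ α * (1 - Real.log t) ^ (-α) := by
        have h6 : ((1 - Real.log t) / 2) ^ (-α) = 2 ^ α * (1 - Real.log t) ^ (-α) := by
          rw [Real.div_rpow (by linarith) (by norm_num), Real.rpow_neg (by norm_num : (0 : ℝ) ≤ 2),
            div_inv_eq_mul, mul_comm]
        rw [← h6]
        exact Real.rpow_le_rpow_of_nonpos (by linarith) (by linarith) (by linarith)
      calc 2 * t * (1 - Real.log (2 * t)) ^ (-α)
          ≤ 2 * t * (2 ^ α * (1 - Real.log t) ^ (-α)) := by gcongr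
        _ = _ := by ring
    · refine le_add_of_nonneg_of_le (by positivity) ?_
      rcases le_or_gt t 1 with h1 | h1
      · have h2 : logCusp α (2 * t) ≤ 2 + α := by
          rw [logCusp_of_one_le (by linarith)]
          nlinarith
        have h3 : m ≤ logCusp α t := hmono.monotoneOn (by norm_num) ht.le h.le
        refine h2.trans ?_
        rw [div_mul_eq_mul_div, le_div_iff₀ hm0]
        exact mul_le_mul_of_nonneg_left h3 (by linarith)
      · refine le_trans ?_ (mul_le_mul_of_nonneg_right hdm hwt)
        rw [logCusp_of_one_le (by linarith), logCusp_of_one_le h1.le]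
        nlinarith [mul_pos hα (sub_pos.2 h1), mul_pos (mul_pos hα hα) (sub_pos.2 h1)]
  · intro s hs t ht hst
    rw [(hasDerivAt_logCusp_of_lt α hs.1 hs.2).deriv, (hasDerivAt_logCusp_of_lt α ht.1 ht.2).deriv]
    have hL := one_le_one_sub_log ht.1 ht.2.le
    have hlog : 1 - Real.log t < 1 - Real.log s := by
      linarith [Real.log_lt_log hs.1 hst]
    refine add_lt_add ?_ (mul_lt_mul_of_pos_left ?_ hα)
    · exact Real.rpow_lt_rpow_of_neg (by linarith) hlog (by linarith)
    · exact Real.rpow_lt_rpow_of_neg (by linarith) hlog (by linarith)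
  · have h1 := tendsto_one_sub_log_rpow hα
    have h2 := (tendsto_one_sub_log_rpow (α := α + 1) (by linarith)).const_mul α
    have h3 := h1.add h2
    rw [mul_zero, add_zero] at h3
    refine h3.congr' ?_
    filter_upwards [Ioo_mem_nhdsGT (one_pos : (0 : ℝ) < 1)] with t ht
    rw [(hasDerivAt_logCusp_of_lt α ht.1 ht.2).deriv, neg_add']

/-! ### Geometry of the cusp domain -/

theorem mem_cuspDomain {w : ℝ → ℝ} {z : 𝔼} : z ∈ cuspDomain n w ↔
    (0 < z 0 ∧ z 0 ≤ 1 ∧ ‖axisProj n z‖ < w (z 0)) ∨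
      z ∈ Metric.ball (EuclideanSpace.single 0 2 : 𝔼) (√2) := by
  rw [axisProj_apply]
  rfl

theorem axisProj_single (a : ℝ) : axisProj n (EuclideanSpace.single 0 a) = 0 := by
  rw [axisProj_apply]
  simp

theorem norm_sq_eq_axisProj (z : 𝔼) : ‖z‖ ^ 2 = z 0 ^ 2 + ‖axisProj n z‖ ^ 2 := by
  rw [EuclideanSpace.real_norm_sq_eq, EuclideanSpace.real_norm_sq_eq,
    ← Finset.add_sum_erase _ _ (Finset.mem_univ (0 : Fin n)),
    ← Finset.add_sum_erase _ (fun i => (axisProj n z) i ^ 2) (Finset.mem_univ (0 : Fin n))]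
  rw [axisProj_coord, if_pos rfl, zero_pow two_ne_zero, zero_add]
  congr 1
  refine Finset.sum_congr rfl fun i hi => ?_
  rw [axisProj_coord, if_neg (Finset.ne_of_mem_erase hi)]

theorem mem_ball_single {z : 𝔼} : z ∈ Metric.ball (EuclideanSpace.single 0 2 : 𝔼) (√2) ↔
    (z 0 - 2) ^ 2 + ‖axisProj n z‖ ^ 2 < 2 := by
  rw [Metric.mem_ball, dist_eq_norm, Real.lt_sqrt (norm_nonneg _), norm_sq_eq_axisProj, map_sub,
    axisProj_single, sub_zero]
  simp

theorem isDomainSet_cuspDomain {w : ℝ → ℝ} (hw : IsCuspFunction w) :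
    IsDomainSet (cuspDomain n w) := by
  have hpos : ∀ t, 0 < t → 0 < w t := fun t ht => by
    have := hw.strictMonoOn (mem_Ici.2 le_rfl) ht.le ht
    rwa [hw.map_zero] at this
  have hP : Continuous fun z : 𝔼 => ‖axisProj n z‖ := by fun_prop
  have h0c : Continuous fun z : 𝔼 => z 0 := by fun_prop
  have hball : Metric.ball (EuclideanSpace.single 0 2 : 𝔼) (√2) ⊆ cuspDomain n w :=
    fun z hz => mem_cuspDomain.2 (Or.inr hz)
  refine ⟨isOpen_iff_mem_nhds.2 fun z hz => ?_, ?_⟩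
  · by_cases hzb : z ∈ Metric.ball (EuclideanSpace.single 0 2 : 𝔼) (√2)
    · exact mem_of_superset (Metric.isOpen_ball.mem_nhds hzb) hball
    · obtain ⟨h0, h1, h2⟩ := (mem_cuspDomain.1 hz).resolve_right hzb
      -- The closed end t = 1 of the cusp does no harm to openness: since w(1) = 1, a point there
      -- has squared distance less than 1 + 1 from (2, 0) and so lies in the ball.
      have h1' : z 0 < 1 := by
        refine lt_of_le_of_ne h1 fun h => hzb (mem_ball_single.2 ?_)
        rw [h, hw.map_one] at h2
        rw [h]
        nlinarith [norm_nonneg (axisProj n z)]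
      have hwc : ContinuousAt (fun z : 𝔼 => w (z 0)) z :=
        ContinuousAt.comp (f := fun z : 𝔼 => z 0) (g := w)
          ((hw.continuousOn _ h0.le).continuousAt (Ici_mem_nhds h0)) h0c.continuousAt
      filter_upwards [h0c.continuousAt.eventually_const_lt h0,
        h0c.continuousAt.eventually_lt_const h1', hP.continuousAt.eventually_lt hwc h2]
        with y hy0 hy1 hy2
      exact mem_cuspDomain.2 (Or.inl ⟨hy0, hy1.le, hy2⟩)
  · have hconv : IsPathConnected (Metric.ball (EuclideanSpace.single 0 2 : 𝔼) (√2)) :=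
      (convex_ball _ _).isPathConnected ⟨_, Metric.mem_ball_self (by positivity)⟩
    have haxis : (EuclideanSpace.single 0 1 : 𝔼) ∈
        Metric.ball (EuclideanSpace.single 0 2 : 𝔼) (√2) := by
      rw [mem_ball_single, axisProj_single]
      norm_num
    refine IsPathConnected.isConnected ⟨EuclideanSpace.single 0 1, hball haxis, fun {z} hz => ?_⟩
    rcases mem_cuspDomain.1 hz with ⟨h0, h1, h2⟩ | hzb
    · have hA : JoinedIn (cuspDomain n w) (EuclideanSpace.single 0 1)
          (EuclideanSpace.single 0 (z 0)) := by
        refine JoinedIn.of_segment_subset ?_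
        rintro _ ⟨a, b, ha, hb, hab, rfl⟩
        refine mem_cuspDomain.2 (Or.inl ?_)
        have hc : (a • EuclideanSpace.single 0 1 + b • EuclideanSpace.single 0 (z 0) : 𝔼) 0 =
            a + b * z 0 := by simp
        have hp : 0 < a + b * z 0 := by
          rcases ha.eq_or_lt with rfl | ha
          · have : b = 1 := by linarith
            rw [this]; linarith
          · positivity
        rw [hc, map_add, map_smul, map_smul, axisProj_single, axisProj_single, smul_zero,
          smul_zero, add_zero, norm_zero]
        exact ⟨hp, by nlinarith, hpos _ hp⟩
      refine hA.trans (JoinedIn.of_segment_subset ?_)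
      rintro _ ⟨a, b, ha, hb, hab, rfl⟩
      refine mem_cuspDomain.2 (Or.inl ?_)
      have hc : (a • EuclideanSpace.single 0 (z 0) + b • z : 𝔼) 0 = z 0 := by
        simp [← add_mul, hab]
      rw [hc, map_add, map_smul, map_smul, axisProj_single, smul_zero, zero_add, norm_smul,
        Real.norm_of_nonneg hb]
      refine ⟨h0, h1, lt_of_le_of_lt ?_ h2⟩
      exact mul_le_of_le_one_left (norm_nonneg _) (by linarith)
    · exact (hconv.joinedIn _ haxis _ hzb).mono hball

/-! ### The cusp is fat but not capacitory dense -/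

/-- The integral of `1 / (t (1 - log (t / 4)))` diverges at the origin. -/
theorem lintegral_inv_log_eq_top :
    ∫⁻ t in Ioo (0 : ℝ) 1, ENNReal.ofReal ((1 - Real.log (t / 4))⁻¹ / t) = ⊤ := by
  set g : ℝ → ℝ := fun t => (1 - Real.log (t / 4))⁻¹ / t with hg
  have hgpos : ∀ t ∈ Ioo (0 : ℝ) 1, 0 < 1 - Real.log (t / 4) := fun t ht => by
    linarith [one_le_one_sub_log (t := t / 4) (by linarith [ht.1]) (by linarith [ht.2])]
  have hder : ∀ t ∈ Ioo (0 : ℝ) 1,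
      HasDerivAt (fun t => Real.log (1 - Real.log (t / 4))) (-g t) t := by
    intro t ht
    have h1 : HasDerivAt (fun t : ℝ => t / 4) (1 / 4) t := (hasDerivAt_id t).div_const 4
    have h2 := ((h1.log (by linarith [ht.1] : t / 4 ≠ 0)).const_sub 1).log (hgpos t ht).ne'
    refine h2.congr_deriv ?_
    have := ht.1.ne'
    have := (hgpos t ht).ne'
    simp only [hg]
    field_simp
  have hmem : Ioo (0 : ℝ) 1 ∈ 𝓝[>] (0 : ℝ) := Ioo_mem_nhdsGT one_pos
  -- An antiderivative of -g is log(1 - log(t/4)), which is unbounded at 0.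
  have hnot : ¬ IntegrableOn g (Ioo 0 1) := by
    refine not_integrableOn_of_tendsto_norm_atTop_of_deriv_isBigO_filter
      (f := fun t => Real.log (1 - Real.log (t / 4))) (𝓝[>] 0) hmem ?_ ?_ ?_
    · filter_upwards [hmem] with t ht using (hder t ht).differentiableAt
    · exact tendsto_norm_atTop_atTop.comp
        (Real.tendsto_log_atTop.comp (tendsto_one_sub_log.comp tendsto_div_four))
    · refine Asymptotics.IsBigO.of_bound 1 ?_
      filter_upwards [hmem] with t ht
      rw [(hder t ht).deriv, norm_neg, one_mul]
  by_contra htop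
  refine hnot ((lintegral_ofReal_ne_top_iff_integrable ?_ ?_).1 htop)
  · have : Measurable g := by
      simp only [hg]
      fun_prop
    exact this.aestronglyMeasurable
  · refine (ae_restrict_iff' measurableSet_Ioo).2 (Eventually.of_forall fun t ht => ?_)
    exact div_nonneg (inv_nonneg.2 (hgpos t ht).le) ht.1.le

theorem abs_coord_zero_le (z : 𝔼) : |z 0| ≤ ‖z‖ := PiLp.norm_apply_le z 0

/-- Cusp domains contain balls of radius comparable to their width. -/
theorem ball_subset_cuspDomain {w : ℝ → ℝ} (hw : IsCuspFunction w) {t : ℝ}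
    (ht1 : t < 1) (hwt : w (t / 4) ≤ t / 4) :
    Metric.ball (EuclideanSpace.single 0 (t / 2) : 𝔼) (w (t / 4)) ⊆
      cuspDomain n w ∩ Metric.ball 0 t := by
  intro z hz
  rw [Metric.mem_ball, dist_eq_norm] at hz
  have h1 := (abs_coord_zero_le (z - EuclideanSpace.single 0 (t / 2))).trans_lt hz
  have h2 := (norm_axisProj_le (z - EuclideanSpace.single 0 (t / 2))).trans_lt hz
  rw [map_sub, axisProj_single, sub_zero] at h2
  simp only [PiLp.sub_apply, PiLp.single_apply, if_true, abs_lt] at h1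
  have ht : 0 < t := by
    have := (norm_nonneg _).trans_lt hz
    linarith
  -- Centre t/2 and radius at most t/4 force z 0 > t/4, where the cusp is at least as wide as the
  -- radius of the ball.
  have h3 : w (t / 4) ≤ w (z 0) :=
    hw.strictMonoOn.monotoneOn (mem_Ici.2 (by linarith)) (mem_Ici.2 (by linarith)) (by linarith)
  refine ⟨mem_cuspDomain.2 (Or.inl ⟨by linarith, by linarith, h2.trans_le h3⟩), ?_⟩
  rw [mem_ball_zero_iff]
  have h4 : ‖(EuclideanSpace.single 0 (t / 2) : 𝔼)‖ = t / 2 := by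
    rw [PiLp.norm_single, Real.norm_of_nonneg (by linarith)]
  have h5 := norm_le_norm_sub_add z (EuclideanSpace.single 0 (t / 2))
  linarith

/-- Near the origin a cusp domain is contained in thin cylinders. -/
theorem cuspDomain_inter_ball_subset {w : ℝ → ℝ} (hw : IsCuspFunction w) {t κ : ℝ} (ht : t ≤ 1 / 4)
    (hwt : w t ≤ κ * t) {z : 𝔼} (hz : z ∈ cuspDomain n w ∩ Metric.ball 0 t) :
    ‖axisProj n z‖ ≤ κ * t := by
  have hzt : ‖z‖ < t := mem_ball_zero_iff.1 hz.2
  have hz0 := abs_le.1 ((abs_coord_zero_le z).trans hzt.le)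
  rcases mem_cuspDomain.1 hz.1 with ⟨h0, -, h2⟩ | hb
  · refine h2.le.trans (le_trans ?_ hwt)
    exact hw.strictMonoOn.monotoneOn h0.le (h0.le.trans hz0.2) hz0.2
  · rw [mem_ball_single] at hb
    -- The ball about (2, 0) only has points with first coordinate above 2 - √2 > 1/4, so it does
    -- not meet B(0, t).
    nlinarith [sq_nonneg ‖axisProj n z‖]

theorem isFat_cuspDomain {q : ℝ} (hq : 1 < q) :
    IsFat q (cuspDomain n (logCusp ((q - 1) / n))) 0 := by
  have hn : 0 < n := NeZero.pos n
  have hn' : (0 : ℝ) < n := by exact_mod_cast hn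
  set α := (q - 1) / n with hα
  have hα0 : 0 < α := div_pos (by linarith) hn'
  have hw := isCuspFunction_logCusp hα0
  have hq0 : 0 < q := by linarith
  have hp : 0 < 1 / (q - 1) := one_div_pos.2 (by linarith)
  obtain ⟨M, hM0, hM⟩ := exists_volume_le_mul_capacity n hn q hq.le
  obtain ⟨A, hA⟩ := exists_capacity_ball_le n hq0
  obtain ⟨B, hB⟩ := exists_le_capacity_ball n hn hq.le
  set c := volume (Metric.ball (0 : 𝔼) 1) with hc
  have hc0 : c ≠ 0 := (Metric.measure_ball_pos _ _ one_pos).ne'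
  have hMt : (M : ℝ≥0∞) ≠ 0 := by exact_mod_cast hM0
  -- The bound A might be 0; adding 1 makes it invertible.
  set A' : ℝ≥0∞ := A + 1 with hA'
  have hA0 : A' ≠ 0 := by simp [hA']
  have hAt : A' ≠ ⊤ := by simp [hA']
  set c' : ℝ≥0∞ := (c * (M : ℝ≥0∞)⁻¹) * (A'⁻¹ * ((4 : ℝ≥0∞) ^ n)⁻¹) with hc'
  have hc'0 : c' ≠ 0 := by
    refine mul_ne_zero (mul_ne_zero hc0 (ENNReal.inv_ne_zero.2 ENNReal.coe_ne_top))
      (mul_ne_zero (ENNReal.inv_ne_zero.2 hAt) (ENNReal.inv_ne_zero.2 ?_))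
    exact ENNReal.pow_ne_top ENNReal.ofNat_ne_top
  have hkey : ∀ t ∈ Ioo (0 : ℝ) 1, c' * ENNReal.ofReal ((1 - Real.log (t / 4))⁻¹ ^ (q - 1)) ≤
      capacity q (cuspDomain n (logCusp α) ∩ Metric.ball 0 t) (annulus 0 (2 * t) (3 * t))
        (Metric.ball 0 (4 * t)) /
      capacity q (Metric.ball (0 : 𝔼) t) (annulus 0 (2 * t) (3 * t)) (Metric.ball 0 (4 * t)) := by
    rintro t ⟨ht0, ht1⟩
    have hL := one_le_one_sub_log (t := t / 4) (by linarith) (by linarith)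
    have hwt : logCusp α (t / 4) = t / 4 * (1 - Real.log (t / 4)) ^ (-α) :=
      logCusp_of_le (by linarith)
    have hwt4 : logCusp α (t / 4) ≤ t / 4 := by
      rw [hwt]
      exact mul_le_of_le_one_right (by linarith)
        (Real.rpow_le_one_of_one_le_of_nonpos hL (by linarith))
    have hwt0 : 0 < logCusp α (t / 4) := by
      rw [hwt]
      positivity
    have hvol := hM 0 t _ ht0 inter_subset_right |>.trans' (measure_mono
      (ball_subset_cuspDomain hw ht1 hwt4))
    rw [Measure.addHaar_ball_of_pos _ _ hwt0, finrank_euclideanSpace_fin, ← hc] at hvol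
    have hD := (hA 0 t ht0).trans (mul_le_mul' le_rfl (le_self_add (a := (A : ℝ≥0∞)) (b := 1)))
    have hBt := hB 0 t ht0
    set N := capacity q (cuspDomain n (logCusp α) ∩ Metric.ball 0 t) (annulus 0 (2 * t) (3 * t))
        (Metric.ball 0 (4 * t))
    set D := capacity q (Metric.ball (0 : 𝔼) t) (annulus 0 (2 * t) (3 * t)) (Metric.ball 0 (4 * t))
    -- The choice α = (q-1)/n makes the n-th power of the width produce exactly the exponent q - 1,
    -- which the root in the thinness integral undoes.
    have hpow : logCusp α (t / 4) ^ n = t ^ n * (4 ^ n)⁻¹ * (1 - Real.log (t / 4))⁻¹ ^ (q - 1) := by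
      rw [hwt, mul_pow, ← Real.rpow_mul_natCast (by linarith),
        Real.inv_rpow (by linarith), ← Real.rpow_neg (by linarith)]
      have : -α * n = -(q - 1) := by rw [hα]; field_simp
      rw [this, div_pow, div_eq_mul_inv]
    rw [hpow, ENNReal.ofReal_mul (by positivity), ENNReal.ofReal_mul (by positivity),
      ENNReal.ofReal_inv_of_pos (by positivity), ENNReal.ofReal_pow ht0.le,
      ENNReal.ofReal_pow (by norm_num), ENNReal.ofReal_ofNat] at hvol
    set X := ENNReal.ofReal ((1 - Real.log (t / 4))⁻¹ ^ (q - 1))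
    have htq0 := ofReal_rpow_ne_zero ht0 q
    have htqt := ofReal_rpow_ne_top ht0 q
    have hσ : ENNReal.ofReal t ^ n * (ENNReal.ofReal t ^ q)⁻¹ ≠ 0 := by
      refine mul_ne_zero (pow_ne_zero n (by simpa using ht0)) (ENNReal.inv_ne_zero.2 htqt)
    have hD0 : D ≠ 0 := by
      intro h
      rw [h, mul_zero, nonpos_iff_eq_zero] at hBt
      exact hσ hBt
    have hDt : D ≠ ⊤ := by
      refine ne_top_of_le_ne_top (ENNReal.mul_ne_top (ENNReal.mul_ne_top ?_ ?_) hAt) hD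
      · exact ENNReal.pow_ne_top ENNReal.ofReal_ne_top
      · exact ENNReal.inv_ne_top.2 htq0
    rw [ENNReal.le_div_iff_mul_le (Or.inl hD0) (Or.inl hDt)]
    set T := ENNReal.ofReal t ^ q
    calc c' * X * D ≤ c' * X * (ENNReal.ofReal t ^ n * T⁻¹ * A') := by gcongr
      _ = (M : ℝ≥0∞)⁻¹ * T⁻¹ * (A' * A'⁻¹) *
          (ENNReal.ofReal t ^ n * (4 ^ n)⁻¹ * X * c) := by rw [hc']; ring
      _ ≤ (M : ℝ≥0∞)⁻¹ * T⁻¹ * (A' * A'⁻¹) * (T * M * N) := by gcongr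
      _ = ((M : ℝ≥0∞) * (M : ℝ≥0∞)⁻¹) * (T * T⁻¹) * (A' * A'⁻¹) * N := by ring
      _ = N := by
        rw [ENNReal.mul_inv_cancel hMt ENNReal.coe_ne_top, ENNReal.mul_inv_cancel htq0 htqt,
          ENNReal.mul_inv_cancel hA0 hAt]
        simp
  clear_value c'
  rw [IsFat, IsThin, if_neg hq.ne', not_lt, top_le_iff, eq_top_iff]
  have hκ : c' ^ (1 / (q - 1)) ≠ 0 := by
    rw [Ne, ENNReal.rpow_eq_zero_iff_of_pos hp]
    exact hc'0
  calc (⊤ : ℝ≥0∞) = c' ^ (1 / (q - 1)) *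
        ∫⁻ t in Ioo (0 : ℝ) 1, ENNReal.ofReal ((1 - Real.log (t / 4))⁻¹ / t) := by
        rw [lintegral_inv_log_eq_top, ENNReal.mul_top hκ]
    _ ≤ ∫⁻ t in Ioo (0 : ℝ) 1,
        c' ^ (1 / (q - 1)) * ENNReal.ofReal ((1 - Real.log (t / 4))⁻¹ / t) :=
        lintegral_const_mul_le _ _
    _ ≤ _ := by
        refine setLIntegral_mono' measurableSet_Ioo fun t ht => ?_
        have hL := one_le_one_sub_log (t := t / 4) (by linarith [ht.1]) (by linarith [ht.2])
        have hinv : 0 < (1 - Real.log (t / 4))⁻¹ := inv_pos.2 (by linarith)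
        rw [ENNReal.ofReal_div_of_pos ht.1, ← mul_div_assoc]
        refine ENNReal.div_le_div_right ?_ _
        refine le_trans (le_of_eq ?_) (ENNReal.rpow_le_rpow (hkey t ht) hp.le)
        rw [ENNReal.mul_rpow_of_nonneg c' _ hp.le, ENNReal.ofReal_rpow_of_pos (by positivity),
          ← Real.rpow_mul hinv.le, mul_one_div_cancel (by linarith), Real.rpow_one]

/-- Any α > 0 works, since only w(t)/t → 0 is needed: at small scales the rescaled cusp fits in the
cylinder of `exists_small_energy`, and its cutoff, dilated, makes the quotient at most δ. -/
theorem not_isCapacitoryDense_cuspDomain {q α : ℝ} (hq : 1 < q) (hqn : q ≤ (n : ℝ) - 1)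
    (hα : 0 < α) : ¬ IsCapacitoryDense q (cuspDomain n (logCusp α)) 0 := by
  intro h
  have hn : 0 < n := NeZero.pos n
  have hw := isCuspFunction_logCusp hα
  obtain ⟨δ, hδ0, hδ⟩ := h.exists_frequently
  obtain ⟨B, hB⟩ := exists_le_capacity_ball n hn hq.le
  have hB1 : (B : ℝ≥0∞) + 1 ≠ ⊤ := by simp
  obtain ⟨κ, hκ, F, hF, hFε⟩ := exists_small_energy n hq hqn
    (ENNReal.div_pos hδ0.ne' hB1)
  refine hδ ?_
  filter_upwards [(tendsto_one_sub_log_rpow hα).eventually_lt_const hκ,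
    Ioc_mem_nhdsGT (show (0 : ℝ) < 1 / 4 by norm_num)] with t htκ ht
  have ht0 : 0 < t := ht.1
  have hwt : logCusp α t ≤ κ * t := by
    rw [logCusp_of_le (by linarith [ht.2]), mul_comm]
    gcongr
  refine not_lt.2 (ENNReal.div_le_of_le_mul ?_)
  have hdil := hF.dilation (S := cuspDomain n (logCusp α) ∩ Metric.ball 0 t) (x := 0) ht0
    fun y hy => by
      have h1 := cuspDomain_inter_ball_subset hw ht.2 hwt hy
      have h2 : ‖y‖ < t := mem_ball_zero_iff.1 hy.2
      rw [sub_zero]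
      refine ⟨?_, ?_⟩
      · rw [norm_smul, norm_inv, Real.norm_of_nonneg ht0.le, inv_mul_le_iff₀ ht0]
        linarith
      · rw [map_smul, norm_smul, norm_inv, Real.norm_of_nonneg ht0.le, inv_mul_le_iff₀ ht0]
        linarith
  refine (hdil.capacity_le fun y hy => by simpa using hy.2.2).trans ?_
  rw [lintegral_fderiv_dilation hF.contDiff 0 ht0 (by linarith)]
  have hBt := hB 0 t ht0
  set D := capacity q (Metric.ball (0 : 𝔼) t) (annulus 0 (2 * t) (3 * t)) (Metric.ball 0 (4 * t))
  calc _ ≤ (B * D) * (δ / (B + 1)) := mul_le_mul' hBt hFε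
    _ ≤ ((B + 1) * D) * (δ / (B + 1)) := by
      gcongr
      exact le_self_add
    _ = ((B + 1) * (δ / (B + 1))) * D := by ring
    _ = δ * D := by rw [ENNReal.mul_div_cancel (by simp) hB1]

end CapacityDensity

theorem mainTheorem11 (n : ℕ) [NeZero n] (hn : 3 ≤ n) :
    (∀ (Ω : Set (EuclideanSpace ℝ (Fin n))) (x : EuclideanSpace ℝ (Fin n)) (q : ℝ),
        CapacityDensity.IsDomainSet Ω → 1 ≤ q →
          CapacityDensity.IsCapacitoryDense q Ω x → CapacityDensity.IsFat q Ω x) ∧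
    (∀ q : ℝ, 1 < q → q ≤ (n : ℝ) - 1 →
      ∃ w : ℝ → ℝ, CapacityDensity.IsCuspFunction w ∧
        CapacityDensity.IsDomainSet (CapacityDensity.cuspDomain n w) ∧
        CapacityDensity.IsFat q (CapacityDensity.cuspDomain n w) 0 ∧
        ¬ CapacityDensity.IsCapacitoryDense q (CapacityDensity.cuspDomain n w) 0) := by
  have hn0 : 0 < n := by omega
  refine ⟨fun Ω x q _ hq h => CapacityDensity.isFat_of_isCapacitoryDense hn0 hq h,
    fun q hq hqn => ?_⟩
  have hα : 0 < (q - 1) / n := div_pos (by linarith) (by exact_mod_cast hn0)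
  have hw := CapacityDensity.isCuspFunction_logCusp hα
  exact ⟨_, hw, CapacityDensity.isDomainSet_cuspDomain hw, CapacityDensity.isFat_cuspDomain hq,
    CapacityDensity.not_isCapacitoryDense_cuspDomain hq hqn hα⟩
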